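/- \textbf{Setting.} For $k\in\{1,2\}$ phase $k$ has a complete equation of state: a pressure $p_k(\rho,e)$, a temperature $T_k(\rho,e)>0$ and an entropy $s_k(\rho,e)$, defined for $\rho,e>0$, with $ds_k=\frac1{T_k}\left(\frac{p_k}{\rho^2}d\rho-de\right)$. Let $e_k(\tau,s)$ be the inverse of $e\mapsto s_k(1/\tau,e)$ and $\mathcal P_k(\tau,s)=p_k(1/\tau,e_k(\tau,s))$. Let $a_1,a_2>0$. A state $W$ consists of $\alpha_1$, $\alpha_2=1-\alpha_1$, and $\rho_k,u_k,s_k,\mathcal T_k$; put $\tau_k=1/\rho_k$, $$\pi_k=\mathcal P_k(\mathcal T_k,s_k)+a_k^2(\mathcal T_k-\tau_k),\qquad \mathcal E_k=\frac{u_k^2}2+e_k(\mathcal T_k,s_k)+\frac{\pi_k^2-\mathcal P_k(\mathcal T_k,s_k)^2}{2a_k^2}.$$ The state is admissible if $0<\alpha_1<1$, $\rho_k>0$, $\mathcal T_k>0$ and $(\mathcal T_k,s_k)$ is in the domain of the equation of state ($s_k=s_k(1/\mathcal T_k,e)$ for some $e>0$), $k=1,2$. \textbf{Solutions.} Let $W_L,W_R$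 be admissible. A \emph{solution with subsonic wave ordering} of the relaxation Riemann problem, with interface velocity $u_2^*$, interface pressure $\pi_1^*$ and dissipation $\mathcal Q\ge0$, is a self-similar function $W(x/t)$ such that: (i) $W(\xi)$ is admissible for all $\xi$; it is piecewise constant, constant away from at most six speeds, one for each of the eigenvalues $u_k-a_k\tau_k,\ u_k,\ u_k+a_k\tau_k$ ($k=1,2$); each of these eigenvalues equals its speed on both sides of it, and the speed of the eigenvalue $u_2$ is $u_2^*$; $W(\xi)=W_L$ if $\xi<\min_k(u_{k,L}-a_k\tau_{k,L})$ and $W(\xi)=W_R$ if $\xi>\max_k(u_{k,R}+a_k\tau_{k,R})$; (ii) for $k=1,2$, in the sense of distributions on $\mathbb R\times(0,\infty)$, $$\partial_t\alpha_k+u_2^*\partial_x\alpha_k=0,\quad \partial_x\alpha_k=(\alpha_{k,R}-\alpha_{k,L})\,\delta_{x-u_2^*t},\quad \partial_t(\alpha_k\rho_k)+\partial_x(\alpha_k\rho_ku_k)=0,$$ $$\partial_t(\alpha_k\rho_ku_k)+\partial_x(\alpha_k\rho_ku_k^2+\alpha_k\pi_k)-\pi_1^*\partial_x\alpha_k=0,$$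 $$\partial_t(\alpha_k\rho_ks_k)+\partial_x(\alpha_k\rho_ks_ku_k)=0,\quad \partial_t(\alpha_k\rho_k\mathcal T_k)+\partial_x(\alpha_k\rho_k\mathcal T_ku_k)=0;$$ (iii) in the sense of distributions $$\partial_t(\alpha_k\rho_k\mathcal E_k)+\partial_x(\alpha_k\rho_k\mathcal E_ku_k+\alpha_k\pi_ku_k)-u_2^*\pi_1^*\partial_x\alpha_k=-\mathcal Q_k\,\delta_{x-u_2^*t},\qquad \mathcal Q_1=\mathcal Q\ge0,\ \mathcal Q_2=0;$$ (iv) $u_{1,L}-a_1\tau_{1,L}<u_2^*<u_{1,R}+a_1\tau_{1,R}$. \textbf{Notation on the data.} $$u_k^\sharp=\tfrac12(u_{k,L}+u_{k,R})-\tfrac1{2a_k}(\pi_{k,R}-\pi_{k,L}),\qquad \pi_k^\sharp=\tfrac12(\pi_{k,R}+\pi_{k,L})-\tfrac{a_k}2(u_{k,R}-u_{k,L}),$$ $$\tau^\sharp_{k,L}=\tau_{k,L}+\tfrac1{a_k}(u_k^\sharp-u_{k,L}),\qquad \tau^\sharp_{k,R}=\tau_{k,R}-\tfrac1{a_k}(u_k^\sharp-u_{k,R}),\qquad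 \Lambda^\alpha=\frac{\alpha_{2,R}-\alpha_{2,L}}{\alpha_{2,R}+\alpha_{2,L}}.$$ A \emph{coupled phase $1$ solution} is a quadruple $(u_2^*,\pi_1^*,\mathcal Q,v)$, where $v(x/t)=(\rho_1,u_1,s_1,\mathcal T_1)(x/t)$, such that, with $\alpha_1(\xi)=\alpha_{1,L}$ for $\xi<u_2^*$ and $\alpha_1(\xi)=\alpha_{1,R}$ for $\xi\ge u_2^*$, phase $1$ satisfies its part of (i)--(iv): admissible values; constant away from $u_2^*$ and three speeds, on both sides of which the eigenvalues $u_1-a_1\tau_1$, $u_1$, $u_1+a_1\tau_1$ respectively equal their speeds; phase $1$ of $W_L$ for $\xi<u_{1,L}-a_1\tau_{1,L}$ and of $W_R$ for $\xi>u_{1,R}+a_1\tau_{1,R}$; the phase $1$ mass, momentum, entropy, $\mathcal T_1$ and energy equations with $\mathcal Q\ge0$; (iv); and such that $\pi_1^*$ is the interface pressure exerted by phase $2$: $$(\alpha_{1,R}-\alpha_{1,L})\,\pi_1^*=(\alpha_{1,R}-\alpha_{1,L})\,\pi_2^\sharp-a_2(\alpha_{2,R}+\alpha_{2,L})(u_2^*-u_2^\sharp).$$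 \textbf{Theorem.} Let $W_L,W_R$ be admissible, let $a_1,a_2>0$ be such that $\tau^\sharp_{k,L}>0$ and $\tau^\sharp_{k,R}>0$ for $k=1,2$, and assume $$(\mathbf A)\qquad -a_1\tau^\sharp_{1,R}<\frac{u_1^\sharp-u_2^\sharp-\frac1{a_2}\Lambda^\alpha(\pi_1^\sharp-\pi_2^\sharp)}{1+\frac{a_1}{a_2}|\Lambda^\alpha|}<a_1\tau^\sharp_{1,L}.$$ Then there exists a coupled phase $1$ solution (in particular with positive phase $1$ densities). Moreover, for every coupled phase $1$ solution $(u_2^*,\pi_1^*,\mathcal Q,v)$ whose velocity $u_2^*$ satisfies the positivity condition for the phase $2$ densities $$(\mathbf B)\qquad u_2^\sharp-a_2\tau^\sharp_{2,L}<u_2^*<u_2^\sharp+a_2\tau^\sharp_{2,R},$$ there exists a solution with subsonic wave ordering of the relaxation Riemann problem with data $W_L,W_R$, with this $u_2^*$, this $\pi_1^*$, this $\mathcal Q$, and phase $1$ part $v$. -/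

import Mathlib

open Filter Topology MeasureTheory Set
open scoped ContDiff

noncomputable section

namespace BaerNunziato

/-! ### Thermodynamics

Phase `1` of the model has index `0 : Fin 2`, phase `2` has index `1 : Fin 2`. -/

/-- A complete equation of state: pressure `p`, temperature `temp` and (mathematical) entropy
`entropy`, as functions of the density and of the specific internal energy (both positive),
subject to the second principle `d s = (1/T) (p/ρ² dρ - de)` with a positive integrating factor
`T`.  No convexity of the entropy is required. -/
structure EOS where
  p : ℝ → ℝ → ℝ
  temp : ℝ → ℝ → ℝ
  entropy : ℝ → ℝ → ℝ
  temp_pos : ∀ ρ e : ℝ, 0 < ρ → 0 < e → 0 < temp ρ e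
  second_law : ∀ ρ e : ℝ, 0 < ρ → 0 < e →
    HasFDerivAt (fun z : ℝ × ℝ => entropy z.1 z.2)
      ((temp ρ e)⁻¹ • ((p ρ e / ρ ^ 2) • ContinuousLinearMap.fst ℝ ℝ ℝ
        - ContinuousLinearMap.snd ℝ ℝ ℝ)) (ρ, e)

namespace EOS

/-- `(τ, s)` is a thermodynamic state: `s` is the entropy of some positive internal energy at the
specific volume `τ`. -/
def InDomain (E : EOS) (τ s : ℝ) : Prop :=
  0 < τ ∧ ∃ e : ℝ, 0 < e ∧ E.entropy τ⁻¹ e = s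

/-- The internal energy `e(τ, s)`: the inverse of the (strictly decreasing) map
`e ↦ s(1/τ, e)` on the positive energies. -/
def energy (E : EOS) (τ s : ℝ) : ℝ :=
  Function.invFunOn (fun e => E.entropy τ⁻¹ e) (Ioi 0) s

/-- The pressure `𝒫(τ, s) = p(1/τ, e(τ, s))`. -/
def pressure (E : EOS) (τ s : ℝ) : ℝ :=
  E.p τ⁻¹ (E.energy τ s)

end EOS

/-! ### States of the relaxation system -/

/-- The unknowns of one phase: density `ρ`, velocity `u`, specific entropy `s` and the additional
relaxation unknown `𝒯` (here `rel`). -/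
structure PhaseState where
  ρ : ℝ
  u : ℝ
  s : ℝ
  rel : ℝ

namespace PhaseState

/-- Specific volume `τ = 1/ρ`. -/
def τ (v : PhaseState) : ℝ := v.ρ⁻¹

/-- Linearized pressure `π = 𝒫(𝒯, s) + a² (𝒯 - τ)`. -/
def relPressure (E : EOS) (a : ℝ) (v : PhaseState) : ℝ :=
  E.pressure v.rel v.s + a ^ 2 * (v.rel - v.τ)

/-- Relaxation total energy `ℰ = u²/2 + e(𝒯, s) + (π² - 𝒫(𝒯, s)²) / (2a²)`. -/
def relEnergy (E : EOS) (a : ℝ) (v : PhaseState) : ℝ :=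
  v.u ^ 2 / 2 + E.energy v.rel v.s
    + (v.relPressure E a ^ 2 - E.pressure v.rel v.s ^ 2) / (2 * a ^ 2)

/-- Positive density, positive `𝒯`, and `(𝒯, s)` in the domain of the equation of state. -/
def Admissible (E : EOS) (v : PhaseState) : Prop :=
  0 < v.ρ ∧ 0 < v.rel ∧ E.InDomain v.rel v.s

/-- The eigenvalues `u - aτ`, `u`, `u + aτ` attached to one phase. -/
def eigenvalue (a : ℝ) (j : Fin 3) (v : PhaseState) : ℝ :=
  ![v.u - a * v.τ, v.u, v.u + a * v.τ] j

end PhaseState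

/-- A state of the relaxation system, recorded by the fraction `α₁` and the phasic unknowns.  On
the admissible set this is equivalent to the vector
`(α₁, α_k ρ_k, α_k ρ_k u_k, α_k ρ_k s_k, α_k ρ_k 𝒯_k)`. -/
structure State where
  α₁ : ℝ
  phase : Fin 2 → PhaseState

namespace State

/-- The phase fractions `α₁` and `α₂ = 1 - α₁`. -/
def frac (W : State) (k : Fin 2) : ℝ := ![W.α₁, 1 - W.α₁] k

/-- The admissible set `Ω_W`. -/
def Admissible (E : Fin 2 → EOS) (W : State) : Prop :=
  0 < W.α₁ ∧ W.α₁ < 1 ∧ ∀ k, (W.phase k).Admissible (E k)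

end State

/-! ### Distributions on `{(x, t) : t > 0}` attached to self-similar functions `f(x/t)` -/

/-- Test functions: smooth with compact support in `ℝ × (0, ∞)`; points are `(x, t)`. -/
def IsTest (φ : ℝ × ℝ → ℝ) : Prop :=
  ContDiff ℝ ∞ φ ∧ HasCompactSupport φ ∧ tsupport φ ⊆ {z | 0 < z.2}

/-- `⟨∂ₜ (f(x/t)), φ⟩`. -/
def distDt (f : ℝ → ℝ) (φ : ℝ × ℝ → ℝ) : ℝ :=
  -∫ z : ℝ × ℝ, f (z.1 / z.2) * fderiv ℝ φ z (0, 1)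

/-- `⟨∂ₓ (f(x/t)), φ⟩`. -/
def distDx (f : ℝ → ℝ) (φ : ℝ × ℝ → ℝ) : ℝ :=
  -∫ z : ℝ × ℝ, f (z.1 / z.2) * fderiv ℝ φ z (1, 0)

/-- `⟨δ_{x - ct}, φ⟩`. -/
def dirac (c : ℝ) (φ : ℝ × ℝ → ℝ) : ℝ :=
  ∫ t in Ioi (0 : ℝ), φ (c * t, t)

/-- The balance equations of one phase, in the sense of distributions, for the self-similar fields
`α(x/t)`, `v(x/t)`, with interface velocity `u₂`, interface pressure `π₁` and dissipation `Q`: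
* mass `∂ₜ(αρ) + ∂ₓ(αρu) = 0`;
* momentum `∂ₜ(αρu) + ∂ₓ(αρu² + απ) - π₁ ∂ₓα = 0`;
* entropy `∂ₜ(αρs) + ∂ₓ(αρsu) = 0`;
* relaxation unknown `∂ₜ(αρ𝒯) + ∂ₓ(αρ𝒯u) = 0`;
* energy `∂ₜ(αρℰ) + ∂ₓ(αρℰu + απu) - u₂ π₁ ∂ₓα = -Q δ_{x - u₂t}`. -/
structure PhaseEquations (E : EOS) (a u₂ π₁ Q : ℝ) (α : ℝ → ℝ) (v : ℝ → PhaseState) :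
    Prop where
  mass : ∀ φ, IsTest φ →
    distDt (fun ξ => α ξ * (v ξ).ρ) φ + distDx (fun ξ => α ξ * (v ξ).ρ * (v ξ).u) φ = 0
  momentum : ∀ φ, IsTest φ →
    distDt (fun ξ => α ξ * (v ξ).ρ * (v ξ).u) φ
      + distDx (fun ξ => α ξ * (v ξ).ρ * (v ξ).u ^ 2 + α ξ * (v ξ).relPressure E a) φ
      - π₁ * distDx α φ = 0
  entropy : ∀ φ, IsTest φ →
    distDt (fun ξ => α ξ * (v ξ).ρ * (v ξ).s) φ
      + distDx (fun ξ => α ξ * (v ξ).ρ * (v ξ).s * (v ξ).u) φ = 0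
  rel : ∀ φ, IsTest φ →
    distDt (fun ξ => α ξ * (v ξ).ρ * (v ξ).rel) φ
      + distDx (fun ξ => α ξ * (v ξ).ρ * (v ξ).rel * (v ξ).u) φ = 0
  energy : ∀ φ, IsTest φ →
    distDt (fun ξ => α ξ * (v ξ).ρ * (v ξ).relEnergy E a) φ
      + distDx (fun ξ => α ξ * (v ξ).ρ * (v ξ).relEnergy E a * (v ξ).u
          + α ξ * (v ξ).relPressure E a * (v ξ).u) φ
      - u₂ * π₁ * distDx α φ = -Q * dirac u₂ φ

/-! ### Riemann solutions with subsonic wave ordering -/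

/-- `W(x/t)` is a solution, with subsonic wave ordering, of the relaxation Riemann problem with
data `WL`, `WR`, with interface velocity `u₂`, interface pressure `π₁` and dissipation `Q`. -/
structure IsSubsonicSolution (E : Fin 2 → EOS) (a : Fin 2 → ℝ) (WL WR : State)
    (W : ℝ → State) (u₂ π₁ Q : ℝ) : Prop where
  admissible : ∀ ξ, (W ξ).Admissible E
  /-- `W` is constant between six speeds `σ k j`, hence has at most seven constant states.  The
  speed `σ k j` belongs to the `j`-th eigenvalue of phase `k`, which takes the value `σ k j` on both
  sides of it (contact discontinuity).  The speed of the eigenvalue `u_2` is `u₂`. -/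
  contacts : ∃ σ : Fin 2 → Fin 3 → ℝ, σ 1 1 = u₂ ∧
    (∀ ξ, (∀ k j, ξ ≠ σ k j) → ∀ᶠ η in 𝓝 ξ, W η = W ξ) ∧
    ∀ k j, ∀ᶠ η in 𝓝[≠] (σ k j), ((W η).phase k).eigenvalue (a k) j = σ k j
  left_state : ∀ ξ, (∀ k, ξ < (WL.phase k).u - a k * (WL.phase k).τ) → W ξ = WL
  right_state : ∀ ξ, (∀ k, (WR.phase k).u + a k * (WR.phase k).τ < ξ) → W ξ = WR
  fraction : ∀ k φ, IsTest φ →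
    distDt (fun ξ => (W ξ).frac k) φ + u₂ * distDx (fun ξ => (W ξ).frac k) φ = 0
  fraction_dirac : ∀ k φ, IsTest φ →
    distDx (fun ξ => (W ξ).frac k) φ = (WR.frac k - WL.frac k) * dirac u₂ φ
  equations_one : PhaseEquations (E 0) (a 0) u₂ π₁ Q
    (fun ξ => (W ξ).frac 0) (fun ξ => (W ξ).phase 0)
  equations_two : PhaseEquations (E 1) (a 1) u₂ π₁ 0
    (fun ξ => (W ξ).frac 1) (fun ξ => (W ξ).phase 1)
  dissipation : 0 ≤ Q
  subsonic_left : (WL.phase 0).u - a 0 * (WL.phase 0).τ < u₂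
  subsonic_right : u₂ < (WR.phase 0).u + a 0 * (WR.phase 0).τ

/-! ### Quantities built on the initial data -/

/-- `u♯_k`. -/
def uSharp (E : Fin 2 → EOS) (a : Fin 2 → ℝ) (WL WR : State) (k : Fin 2) : ℝ :=
  ((WL.phase k).u + (WR.phase k).u) / 2
    - ((WR.phase k).relPressure (E k) (a k) - (WL.phase k).relPressure (E k) (a k)) / (2 * a k)

/-- `π♯_k`. -/
def piSharp (E : Fin 2 → EOS) (a : Fin 2 → ℝ) (WL WR : State) (k : Fin 2) : ℝ :=
  ((WR.phase k).relPressure (E k) (a k) + (WL.phase k).relPressure (E k) (a k)) / 2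
    - a k / 2 * ((WR.phase k).u - (WL.phase k).u)

/-- `τ♯_{k,L}`. -/
def tauSharpL (E : Fin 2 → EOS) (a : Fin 2 → ℝ) (WL WR : State) (k : Fin 2) : ℝ :=
  (WL.phase k).τ + (uSharp E a WL WR k - (WL.phase k).u) / a k

/-- `τ♯_{k,R}`. -/
def tauSharpR (E : Fin 2 → EOS) (a : Fin 2 → ℝ) (WL WR : State) (k : Fin 2) : ℝ :=
  (WR.phase k).τ - (uSharp E a WL WR k - (WR.phase k).u) / a k

/-- `Λ^α = (α_{2,R} - α_{2,L}) / (α_{2,R} + α_{2,L})`. -/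
def lambdaAlpha (WL WR : State) : ℝ :=
  (WR.frac 1 - WL.frac 1) / (WR.frac 1 + WL.frac 1)

/-- The central expression of condition (A). -/
def USharp (E : Fin 2 → EOS) (a : Fin 2 → ℝ) (WL WR : State) : ℝ :=
  (uSharp E a WL WR 0 - uSharp E a WL WR 1
      - 1 / a 1 * lambdaAlpha WL WR * (piSharp E a WL WR 0 - piSharp E a WL WR 1))
    / (1 + a 0 / a 1 * |lambdaAlpha WL WR|)

/-- Condition (A). -/
def ConditionA (E : Fin 2 → EOS) (a : Fin 2 → ℝ) (WL WR : State) : Prop :=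
  -(a 0 * tauSharpR E a WL WR 0) < USharp E a WL WR ∧
    USharp E a WL WR < a 0 * tauSharpL E a WL WR 0

/-- Condition (B) on the velocity `u₂` of the phase fraction wave: positivity of the phase 2
densities. -/
def ConditionB (E : Fin 2 → EOS) (a : Fin 2 → ℝ) (WL WR : State) (u₂ : ℝ) : Prop :=
  uSharp E a WL WR 1 - a 1 * tauSharpL E a WL WR 1 < u₂ ∧
    u₂ < uSharp E a WL WR 1 + a 1 * tauSharpR E a WL WR 1

/-! ### The part of a solution that does not require the positivity of the phase 2 densities -/

/-- `v(x/t)` is the phase 1 part of a Riemann solution with subsonic wave ordering: the phase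
fraction `α₁` jumps from its left to its right value at speed `u₂`, phase 1 has all the properties
required in `IsSubsonicSolution`, and the interface pressure `π₁` is the one that phase 2 exerts when
its contact discontinuity moves at speed `u₂`, namely
`π₁ = π♯_2 - a_2 (α_{2,R} + α_{2,L}) / (α_{1,R} - α_{1,L}) (u₂ - u♯_2)` if `α_{1,L} ≠ α_{1,R}`
(and `u₂ = u♯_2` if `α_{1,L} = α_{1,R}`). -/
structure IsPhaseOneSolution (E : Fin 2 → EOS) (a : Fin 2 → ℝ) (WL WR : State)
    (v : ℝ → PhaseState) (u₂ π₁ Q : ℝ) : Prop where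
  admissible : ∀ ξ, (v ξ).Admissible (E 0)
  contacts : ∃ σ : Fin 3 → ℝ,
    (∀ ξ, ξ ≠ u₂ → (∀ j, ξ ≠ σ j) → ∀ᶠ η in 𝓝 ξ, v η = v ξ) ∧
    ∀ j, ∀ᶠ η in 𝓝[≠] (σ j), (v η).eigenvalue (a 0) j = σ j
  left_state : ∀ ξ, ξ < (WL.phase 0).u - a 0 * (WL.phase 0).τ → v ξ = WL.phase 0
  right_state : ∀ ξ, (WR.phase 0).u + a 0 * (WR.phase 0).τ < ξ → v ξ = WR.phase 0
  equations : PhaseEquations (E 0) (a 0) u₂ π₁ Q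
    (fun ξ => if ξ < u₂ then WL.frac 0 else WR.frac 0) v
  coupling : (WR.frac 0 - WL.frac 0) * π₁ =
    (WR.frac 0 - WL.frac 0) * piSharp E a WL WR 1
      - a 1 * (WR.frac 1 + WL.frac 1) * (u₂ - uSharp E a WL WR 1)
  dissipation : 0 ≤ Q
  subsonic_left : (WL.phase 0).u - a 0 * (WL.phase 0).τ < u₂
  subsonic_right : u₂ < (WR.phase 0).u + a 0 * (WR.phase 0).τ

end BaerNunziato

end

/-! For piecewise constant self-similar fields, every balance law reduces to a jump relation at each
speed. All fields here are fans of constant states, and `phaseEquations_fan` turns the theorem into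
algebra. The entropy and `rel` jump only across material contacts. At every other wave the energy
defect is half the mass flux times the jump of `(u - σ)² - a²τ²` (`energyDefect_of_transported`),
which vanishes for acoustic waves. Dissipation can therefore occur only where phase 1 crosses the
interface.

For phase 1, let `A`, `B` be `a₁τ♯_{1,L}`, `a₁τ♯_{1,R}` and let `c = u♯_1 - u₂`. If `c > 0`, mass
flows rightwards. The states around the interface are explicit in terms of `c` and the incoming Mach
number `M`; mass conservation makes the outgoing Mach number `N = (α_{1,L}/α_{1,R}) M`. Eliminating
`π₁` between the momentum jump of phase 1 and the coupling with phase 2 leaves one affine relation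
`c = c₀ + kM`, where `c₀ = θ U`, `U` is the central expression of (A) and `0 < θ ≤ 1`. Hence (A)
gives `-B < c₀ < A`. For `U > 0` and unequal fractions, positivity of the densities and of the
dissipation are strict inequalities at `M = 0`, so they hold for small `M > 0` (`exists_mach`). For
equal fractions `M = U/A` is forced and the dissipation is zero. The case `U < 0` is the mirror
image, and for `U = 0` the material contact rides on the interface.

For phase 2, the material contact moves at speed `u₂`: the coupling relation is exactly its momentum
jump, and (B) is exactly the positivity of its two intermediate specific volumes
(`IsPhaseOneSolution.exists_isSubsonicSolution`). -/

noncomputable section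

namespace BaerNunziato

/-! ### Self-similar step functions as distributions -/

namespace IsTest

variable {φ : ℝ × ℝ → ℝ}

theorem contDiff (h : IsTest φ) : ContDiff ℝ ∞ φ := h.1

theorem fderiv_eq_zero_of_nonpos (h : IsTest φ) {z : ℝ × ℝ} (hz : z.2 ≤ 0) (d : ℝ × ℝ) :
    fderiv ℝ φ z d = 0 := by
  have : z ∉ tsupport φ := fun hm => (h.2.2 hm).not_ge hz
  have h0 : fderiv ℝ φ z = 0 :=
    image_eq_zero_of_notMem_tsupport fun hm => this (tsupport_fderiv_subset ℝ hm)
  simp [h0]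

theorem differentiableAt (h : IsTest φ) (z : ℝ × ℝ) : DifferentiableAt ℝ φ z :=
  h.contDiff.differentiable (by simp) z

theorem continuous_fderiv_apply (h : IsTest φ) (d : ℝ × ℝ) :
    Continuous fun z => fderiv ℝ φ z d :=
  (h.contDiff.continuous_fderiv (by simp)).clm_apply continuous_const

theorem integrable_fderiv_apply (h : IsTest φ) (d : ℝ × ℝ) :
    Integrable fun z => fderiv ℝ φ z d :=
  (h.continuous_fderiv_apply d).integrable_of_hasCompactSupport (h.2.1.fderiv_apply ℝ d)

theorem integrable_mul_fderiv_apply (h : IsTest φ) {f : ℝ → ℝ} (hf : Measurable f) {C : ℝ}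
    (hC : ∀ ξ, |f ξ| ≤ C) (d : ℝ × ℝ) :
    Integrable fun z : ℝ × ℝ => f (z.1 / z.2) * fderiv ℝ φ z d :=
  (h.integrable_fderiv_apply d).bdd_mul (c := C)
    (hf.comp (measurable_fst.div measurable_snd)).aestronglyMeasurable
    (Eventually.of_forall fun z => by simpa using hC _)

end IsTest

/-- The indicator function of `ξ < c`. -/
def leftOf (c ξ : ℝ) : ℝ := if ξ < c then 1 else 0

theorem measurable_leftOf (c : ℝ) : Measurable (leftOf c) :=
  Measurable.ite measurableSet_Iio measurable_const measurable_const

theorem abs_leftOf_le (c ξ : ℝ) : |leftOf c ξ| ≤ 1 := by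
  unfold leftOf; split_ifs <;> simp

/-- The line `x ↦ (x, t)` composed with a test function. -/
theorem IsTest.hasDerivAt_fst {φ : ℝ × ℝ → ℝ} (h : IsTest φ) (x t : ℝ) :
    HasDerivAt (fun x => φ (x, t)) (fderiv ℝ φ (x, t) (1, 0)) x :=
  (h.differentiableAt (x, t)).hasFDerivAt.comp_hasDerivAt x
    ((hasDerivAt_id x).prodMk (hasDerivAt_const x t))

/-- The line `t ↦ (y + ct, t)` composed with a test function. -/
theorem IsTest.hasDerivAt_ray {φ : ℝ × ℝ → ℝ} (h : IsTest φ) (c y t : ℝ) :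
    HasDerivAt (fun t => φ (y + c * t, t)) (fderiv ℝ φ (y + c * t, t) (c, 1)) t := by
  have h1 : HasDerivAt (fun t : ℝ => (y + c * t, t)) (c, 1) t := by
    simpa using (((hasDerivAt_id t).const_mul c).const_add y).prodMk (hasDerivAt_id t)
  exact HasFDerivAt.comp_hasDerivAt (f := fun t : ℝ => (y + c * t, t)) t
    (h.differentiableAt (y + c * t, t)).hasFDerivAt h1

theorem isClosedEmbedding_prodMk_const (t : ℝ) :
    IsClosedEmbedding fun x : ℝ => (x, t) :=
  Topology.IsClosedEmbedding.of_continuous_injective_isClosedMap (by fun_prop)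
    (fun x y hxy => (Prod.ext_iff.1 hxy).1) (isClosedMap_prodMk_right t)

/-- The shear `(t, y) ↦ (y + ct, t)`. -/
def shear (c : ℝ) : ℝ × ℝ ≃ₜ ℝ × ℝ where
  toFun z := (z.2 + c * z.1, z.1)
  invFun z := (z.2, z.1 - c * z.2)
  left_inv z := by simp
  right_inv z := by simp

theorem distDx_leftOf (c : ℝ) {φ : ℝ × ℝ → ℝ} (h : IsTest φ) :
    distDx (leftOf c) φ = -dirac c φ := by
  unfold distDx dirac
  rw [neg_inj, Measure.volume_eq_prod, integral_prod_symm _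
    (h.integrable_mul_fderiv_apply (measurable_leftOf c) (abs_leftOf_le c) (1, 0)),
    ← setIntegral_eq_integral_of_forall_compl_eq_zero (s := Ioi 0)]
  · refine setIntegral_congr_fun measurableSet_Ioi fun t (ht : 0 < t) => ?_
    have h1 : ContDiff ℝ 1 fun x => φ (x, t) :=
      (h.contDiff.of_le (by simp)).comp (contDiff_id.prodMk contDiff_const)
    have h2 : HasCompactSupport fun x => φ (x, t) :=
      h.2.1.comp_isClosedEmbedding (isClosedEmbedding_prodMk_const t)
    have h3 := h2.integral_Iic_deriv_eq h1 (c * t)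
    rw [integral_Iic_eq_integral_Iio, ← integral_indicator measurableSet_Iio] at h3
    rw [← h3]
    refine integral_congr_ae (Eventually.of_forall fun x => ?_)
    simp only [leftOf, indicator, mem_Iio, div_lt_iff₀ ht, (h.hasDerivAt_fst x t).deriv]
    split_ifs <;> simp
  · intro t ht
    simp [h.fderiv_eq_zero_of_nonpos (z := (_, t)) (not_lt.1 ht)]

/-- The step is constant along the rays `x = y + ct`. After shearing to the coordinates `(t, y)`,
the derivative in direction `(c, 1)` is a total `t`-derivative of a compactly supported function.
The time derivative of the step then follows from its space derivative. -/
theorem integral_leftOf_mul_fderiv_ray (c : ℝ) {φ : ℝ × ℝ → ℝ} (h : IsTest φ) :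
    ∫ z : ℝ × ℝ, leftOf c (z.1 / z.2) * fderiv ℝ φ z (c, 1) = 0 := by
  rw [Measure.volume_eq_prod, integral_prod_symm _
    (h.integrable_mul_fderiv_apply (measurable_leftOf c) (abs_leftOf_le c) (c, 1))]
  have hint : Integrable (Function.uncurry fun t y : ℝ =>
      leftOf 0 y * fderiv ℝ φ (y + c * t, t) (c, 1)) (volume.prod volume) := by
    have h1 : Integrable (fun z => fderiv ℝ φ (shear c z) (c, 1)) :=
      ((h.continuous_fderiv_apply (c, 1)).comp (shear c).continuous).integrable_of_hasCompactSupport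
        ((h.2.1.fderiv_apply ℝ (c, 1)).comp_homeomorph (shear c))
    exact h1.bdd_mul (c := 1) ((measurable_leftOf 0).comp measurable_snd).aestronglyMeasurable
      (Eventually.of_forall fun z => by simpa using abs_leftOf_le 0 _)
  have hswap := integral_integral_swap hint
  have hin : ∀ t : ℝ, ∫ x : ℝ, leftOf c (x / t) * fderiv ℝ φ (x, t) (c, 1)
      = ∫ y : ℝ, leftOf 0 y * fderiv ℝ φ (y + c * t, t) (c, 1) := by
    intro t
    rcases le_or_gt t 0 with ht | ht
    · simp [h.fderiv_eq_zero_of_nonpos (z := (_, t)) ht]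
    -- For `t > 0` the condition `(y + ct)/t < c` is `y < 0`, independent of `t`. For `t ≤ 0` both
    -- integrands vanish, so the same weight may be used for all times.
    · rw [← integral_add_right_eq_self _ (c * t)]
      refine integral_congr_ae (Eventually.of_forall fun y => ?_)
      simp [leftOf, div_lt_iff₀ ht]
  simp only [hin]
  rw [hswap]
  refine integral_eq_zero_of_ae (Eventually.of_forall fun y => ?_)
  simp only [integral_const_mul]
  have hcs : HasCompactSupport fun t => φ (y + c * t, t) := by
    have h2 := (h.2.1.comp_homeomorph (shear c))
    exact h2.comp_isClosedEmbedding (g := fun t : ℝ => (t, y)) (isClosedEmbedding_prodMk_const y)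
  have hcs' : HasCompactSupport fun t => fderiv ℝ φ (y + c * t, t) (c, 1) := by
    have h2 := ((h.2.1.fderiv_apply ℝ (c, 1)).comp_homeomorph (shear c))
    exact h2.comp_isClosedEmbedding (g := fun t : ℝ => (t, y)) (isClosedEmbedding_prodMk_const y)
  have hc : Continuous fun t => φ (y + c * t, t) := h.contDiff.continuous.comp (by fun_prop)
  have hc' : Continuous fun t => fderiv ℝ φ (y + c * t, t) (c, 1) :=
    (h.continuous_fderiv_apply (c, 1)).comp (by fun_prop : Continuous fun t => (y + c * t, t))
  rw [integral_eq_zero_of_hasDerivAt_of_integrable (h.hasDerivAt_ray c y)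
    (hc'.integrable_of_hasCompactSupport hcs') (hc.integrable_of_hasCompactSupport hcs)]
  simp

theorem distDt_leftOf (c : ℝ) {φ : ℝ × ℝ → ℝ} (h : IsTest φ) :
    distDt (leftOf c) φ = c * dirac c φ := by
  have h1 := integral_leftOf_mul_fderiv_ray c h
  have h2 : ∀ z, fderiv ℝ φ z (c, 1) = c * fderiv ℝ φ z (1, 0) + fderiv ℝ φ z (0, 1) := by
    intro z
    rw [← smul_eq_mul, ← map_smul, ← map_add]
    simp
  have h3 := distDx_leftOf c h
  have i1 := h.integrable_mul_fderiv_apply (measurable_leftOf c) (abs_leftOf_le c) (1, 0)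
  have i2 := h.integrable_mul_fderiv_apply (measurable_leftOf c) (abs_leftOf_le c) (0, 1)
  simp only [h2, mul_add, mul_left_comm _ c] at h1
  rw [integral_add (i1.const_mul c) i2, integral_const_mul] at h1
  unfold distDx at h3
  unfold distDt
  linear_combination (-1) * h1 - c * h3

/-! ### Piecewise constant functions of the similarity variable -/

/-- The piecewise constant function with value `w` on the left of the first speed, and then the
state listed with each speed on the right of that speed. -/
def fan {X : Type*} : X → List (ℝ × X) → ℝ → X
  | w, [], _ => w
  | w, (s, w') :: l, ξ => if ξ < s then w else fan w' l ξ

/-- The sum of a quantity over the jumps of a fan. -/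
def jumpSum {X : Type*} (J : ℝ → X → X → ℝ) : X → List (ℝ × X) → ℝ
  | _, [] => 0
  | w, (s, w') :: l => J s w w' + jumpSum J w' l

/-- A relation holds across all the jumps of a fan. -/
def AcrossJumps {X : Type*} (J : ℝ → X → X → Prop) : X → List (ℝ × X) → Prop
  | _, [] => True
  | w, (s, w') :: l => J s w w' ∧ AcrossJumps J w' l

/-- The speeds of a fan are in nondecreasing order. -/
def SpeedsSorted {X : Type*} (l : List (ℝ × X)) : Prop :=
  l.Pairwise fun p q => p.1 ≤ q.1

section Fan

variable {X : Type*}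

theorem fan_of_forall_lt {w : X} {l : List (ℝ × X)} {ξ : ℝ} (h : ∀ p ∈ l, ξ < p.1) :
    fan w l ξ = w := by
  cases l with
  | nil => rfl
  | cons p l => exact if_pos (h p (by simp))

theorem forall_fan {P : X → Prop} {w : X} {l : List (ℝ × X)} (hw : P w)
    (hl : ∀ p ∈ l, P p.2) (ξ : ℝ) : P (fan w l ξ) := by
  induction l generalizing w with
  | nil => exact hw
  | cons p l ih =>
    unfold fan
    split_ifs
    · exact hw
    · exact ih (hl p (by simp)) fun q hq => hl q (by simp [hq])

theorem fan_eventually_eq {w : X} {l : List (ℝ × X)} {ξ : ℝ} (h : ∀ p ∈ l, ξ ≠ p.1) :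
    ∀ᶠ η in 𝓝 ξ, fan w l η = fan w l ξ := by
  induction l generalizing w with
  | nil => exact Eventually.of_forall fun _ => rfl
  | cons p l ih =>
    have ih' := ih (w := p.2) fun q hq => h q (by simp [hq])
    rcases lt_or_gt_of_ne (h p (by simp)) with hp | hp
    · filter_upwards [eventually_lt_nhds hp] with η hη
      simp [fan, hη, hp]
    · filter_upwards [eventually_gt_nhds hp, ih'] with η hη h2
      simp [fan, not_lt.2 hη.le, not_lt.2 hp.le, h2]

theorem measurable_fan (f : X → ℝ) (w : X) (l : List (ℝ × X)) :
    Measurable fun ξ => f (fan w l ξ) := by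
  induction l generalizing w with
  | nil => simp only [fan, measurable_const]
  | cons p l ih =>
    simp only [fan, apply_ite f]
    exact Measurable.ite measurableSet_Iio measurable_const (ih p.2)

theorem exists_abs_fan_le (f : X → ℝ) (w : X) (l : List (ℝ × X)) :
    ∃ C, ∀ ξ, |f (fan w l ξ)| ≤ C := by
  induction l generalizing w with
  | nil => exact ⟨|f w|, fun _ => le_rfl⟩
  | cons p l ih =>
    obtain ⟨C, hC⟩ := ih p.2
    refine ⟨max |f w| C, fun ξ => ?_⟩
    unfold fan
    split_ifs
    · exact le_max_left _ _
    · exact (hC ξ).trans (le_max_right _ _)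

/-- Peeling off the first jump as a multiple of a step function. Sortedness is needed so that the
remaining fan still has its leftmost value `w'` on `ξ < s`. -/
theorem fan_cons_eq (f : X → ℝ) (w : X) {s : ℝ} {w' : X} {l : List (ℝ × X)}
    (hl : SpeedsSorted ((s, w') :: l)) (ξ : ℝ) :
    f (fan w ((s, w') :: l) ξ) = (f w - f w') * leftOf s ξ + f (fan w' l ξ) := by
  unfold leftOf
  by_cases h : ξ < s
  · have h1 : fan w' l ξ = w' :=
      fan_of_forall_lt fun p hp => h.trans_le ((List.pairwise_cons.1 hl).1 p hp)
    simp [fan, h, h1]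
  · simp [fan, h]

theorem IsTest.integral_const_mul_fderiv {φ : ℝ × ℝ → ℝ} (h : IsTest φ) (C : ℝ) (d : ℝ × ℝ) :
    ∫ z, C * fderiv ℝ φ z d = 0 := by
  rw [integral_mul_fderiv_eq_neg_fderiv_mul_of_integrable (f := fun _ => C)]
  · simp
  · simp
  · exact (h.integrable_fderiv_apply d).const_mul C
  · exact (h.contDiff.continuous.integrable_of_hasCompactSupport h.2.1).const_mul C
  · fun_prop
  · exact fun x _ => h.differentiableAt x

variable {φ : ℝ × ℝ → ℝ}

/-- The integral of a fan against a derivative of a test function, given those of the steps. -/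
theorem IsTest.neg_integral_fan (h : IsTest φ) (d : ℝ × ℝ) (κ : ℝ → ℝ)
    (hκ : ∀ c, -∫ z : ℝ × ℝ, leftOf c (z.1 / z.2) * fderiv ℝ φ z d = κ c)
    (f : X → ℝ) (w : X) (l : List (ℝ × X)) (hl : SpeedsSorted l) :
    -∫ z : ℝ × ℝ, f (fan w l (z.1 / z.2)) * fderiv ℝ φ z d
      = jumpSum (fun s w w' => (f w - f w') * κ s) w l := by
  induction l generalizing w with
  | nil => simp [fan, jumpSum, h.integral_const_mul_fderiv]
  | cons p l ih =>
    obtain ⟨s, w'⟩ := p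
    obtain ⟨C, hC⟩ := exists_abs_fan_le f w' l
    have i1 := h.integrable_mul_fderiv_apply (measurable_leftOf s) (abs_leftOf_le s) d
    have i2 := h.integrable_mul_fderiv_apply (measurable_fan f w' l) hC d
    simp only [fan_cons_eq f w hl, add_mul, mul_assoc]
    rw [integral_add (i1.const_mul _) i2, integral_const_mul]
    simp only [jumpSum]
    rw [← ih w' (List.pairwise_cons.1 hl).2, ← hκ s]
    ring

theorem distDx_fan (h : IsTest φ) (f : X → ℝ) (w : X) {l : List (ℝ × X)}
    (hl : SpeedsSorted l) :
    distDx (fun ξ => f (fan w l ξ)) φ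
      = jumpSum (fun s w w' => (f w' - f w) * dirac s φ) w l := by
  have := h.neg_integral_fan (1, 0) (fun c => -dirac c φ) (fun c => distDx_leftOf c h) f w l hl
  simp only [mul_neg, ← neg_mul, neg_sub] at this
  exact this

theorem distDt_fan (h : IsTest φ) (f : X → ℝ) (w : X) {l : List (ℝ × X)}
    (hl : SpeedsSorted l) :
    distDt (fun ξ => f (fan w l ξ)) φ
      = jumpSum (fun s w w' => (f w - f w') * (s * dirac s φ)) w l :=
  h.neg_integral_fan (0, 1) (fun c => c * dirac c φ) (fun c => distDt_leftOf c h) f w l hl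

theorem jumpSum_add (J K : ℝ → X → X → ℝ) (w : X) (l : List (ℝ × X)) :
    jumpSum J w l + jumpSum K w l = jumpSum (fun s w w' => J s w w' + K s w w') w l := by
  induction l generalizing w with
  | nil => simp [jumpSum]
  | cons p l ih => simp only [jumpSum, ← ih]; ring

theorem jumpSum_sub_const_mul (c : ℝ) (J K : ℝ → X → X → ℝ) (w : X) (l : List (ℝ × X)) :
    jumpSum J w l - c * jumpSum K w l = jumpSum (fun s w w' => J s w w' - c * K s w w') w l := by
  induction l generalizing w with
  | nil => simp [jumpSum]
  | cons p l ih => simp only [jumpSum, ← ih]; ring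

theorem jumpSum_eq_zero {J : ℝ → X → X → ℝ} {w : X} {l : List (ℝ × X)}
    (h : AcrossJumps (fun s w w' => J s w w' = 0) w l) : jumpSum J w l = 0 := by
  induction l generalizing w with
  | nil => rfl
  | cons p l ih => simp only [jumpSum, h.1, ih h.2, add_zero]

theorem AcrossJumps.imp {J K : ℝ → X → X → Prop} (hJK : ∀ s w w', J s w w' → K s w w') {w : X}
    {l : List (ℝ × X)} (h : AcrossJumps J w l) : AcrossJumps K w l := by
  induction l generalizing w with
  | nil => trivial
  | cons p l ih => exact ⟨hJK _ _ _ h.1, ih h.2⟩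

end Fan

/-! ### Rankine–Hugoniot relations of one phase -/

/-- Rankine–Hugoniot relations at speed `σ` for the mass, momentum, entropy and relaxation
equations of one phase, between the pairs `w`, `w'` of a phase fraction and a phase state. -/
structure RankineHugoniot (E : EOS) (a π₁ σ : ℝ) (w w' : ℝ × PhaseState) : Prop where
  mass : w'.1 * w'.2.ρ * (w'.2.u - σ) = w.1 * w.2.ρ * (w.2.u - σ)
  momentum : w'.1 * (w'.2.ρ * w'.2.u * (w'.2.u - σ) + w'.2.relPressure E a)
      - w.1 * (w.2.ρ * w.2.u * (w.2.u - σ) + w.2.relPressure E a) = π₁ * (w'.1 - w.1)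
  entropy : w'.1 * w'.2.ρ * w'.2.s * (w'.2.u - σ) = w.1 * w.2.ρ * w.2.s * (w.2.u - σ)
  rel : w'.1 * w'.2.ρ * w'.2.rel * (w'.2.u - σ) = w.1 * w.2.ρ * w.2.rel * (w.2.u - σ)

/-- The defect of the energy equation across a jump of speed `σ`. -/
def energyDefect (E : EOS) (a u₂ π₁ σ : ℝ) (w w' : ℝ × PhaseState) : ℝ :=
  w'.1 * (w'.2.ρ * w'.2.relEnergy E a * (w'.2.u - σ) + w'.2.relPressure E a * w'.2.u)
    - w.1 * (w.2.ρ * w.2.relEnergy E a * (w.2.u - σ) + w.2.relPressure E a * w.2.u)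
    - u₂ * π₁ * (w'.1 - w.1)

/-- In each equation a jump of speed `s` contributes its Rankine–Hugoniot defect times `dirac s φ`.
The arbitrary weight `δ` in the energy hypothesis stands for `c ↦ dirac c φ`, which keeps test
functions out of the wave computations. -/
theorem phaseEquations_fan {E : EOS} {a u₂ π₁ Q : ℝ} {w : ℝ × PhaseState}
    {l : List (ℝ × (ℝ × PhaseState))} (hl : SpeedsSorted l)
    (hRH : AcrossJumps (RankineHugoniot E a π₁) w l)
    (hQ : ∀ δ : ℝ → ℝ,
      jumpSum (fun σ w w' => energyDefect E a u₂ π₁ σ w w' * δ σ) w l = -Q * δ u₂) :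
    PhaseEquations E a u₂ π₁ Q (fun ξ => (fan w l ξ).1) (fun ξ => (fan w l ξ).2) where
  mass φ hφ := by
    rw [distDt_fan hφ (fun w : ℝ × PhaseState => w.1 * w.2.ρ) w hl,
      distDx_fan hφ (fun w : ℝ × PhaseState => w.1 * w.2.ρ * w.2.u) w hl, jumpSum_add]
    refine jumpSum_eq_zero (hRH.imp fun s w w' h => ?_)
    linear_combination dirac s φ * h.mass
  momentum φ hφ := by
    rw [distDt_fan hφ (fun w : ℝ × PhaseState => w.1 * w.2.ρ * w.2.u) w hl,
      distDx_fan hφ (fun w : ℝ × PhaseState =>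
        w.1 * w.2.ρ * w.2.u ^ 2 + w.1 * w.2.relPressure E a) w hl, jumpSum_add,
      distDx_fan hφ (fun w : ℝ × PhaseState => w.1) w hl, jumpSum_sub_const_mul]
    refine jumpSum_eq_zero (hRH.imp fun s w w' h => ?_)
    linear_combination dirac s φ * h.momentum
  entropy φ hφ := by
    rw [distDt_fan hφ (fun w : ℝ × PhaseState => w.1 * w.2.ρ * w.2.s) w hl,
      distDx_fan hφ (fun w : ℝ × PhaseState => w.1 * w.2.ρ * w.2.s * w.2.u) w hl, jumpSum_add]
    refine jumpSum_eq_zero (hRH.imp fun s w w' h => ?_)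
    linear_combination dirac s φ * h.entropy
  rel φ hφ := by
    rw [distDt_fan hφ (fun w : ℝ × PhaseState => w.1 * w.2.ρ * w.2.rel) w hl,
      distDx_fan hφ (fun w : ℝ × PhaseState => w.1 * w.2.ρ * w.2.rel * w.2.u) w hl, jumpSum_add]
    refine jumpSum_eq_zero (hRH.imp fun s w w' h => ?_)
    linear_combination dirac s φ * h.rel
  energy φ hφ := by
    rw [distDt_fan hφ (fun w : ℝ × PhaseState => w.1 * w.2.ρ * w.2.relEnergy E a) w hl,
      distDx_fan hφ (fun w : ℝ × PhaseState => w.1 * w.2.ρ * w.2.relEnergy E a * w.2.u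
        + w.1 * w.2.relPressure E a * w.2.u) w hl, jumpSum_add,
      distDx_fan hφ (fun w : ℝ × PhaseState => w.1) w hl, jumpSum_sub_const_mul,
      ← hQ fun c => dirac c φ]
    congr 1
    funext s w w'
    unfold energyDefect
    ring

/-! ### Elementary waves -/

theorem relPressure_sub_of_eq {E : EOS} {a : ℝ} {v v' : PhaseState} (hs : v'.s = v.s)
    (hrel : v'.rel = v.rel) :
    v'.relPressure E a - v.relPressure E a = a ^ 2 * (v.τ - v'.τ) := by
  simp only [PhaseState.relPressure, hs, hrel]
  ring

/-- Rankine–Hugoniot relations when the entropy and the relaxation unknown do not jump. -/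
theorem RankineHugoniot.of_transported {E : EOS} {a π₁ σ α α' : ℝ} {v v' : PhaseState}
    (hs : v'.s = v.s) (hrel : v'.rel = v.rel)
    (hm : α' * v'.ρ * (v'.u - σ) = α * v.ρ * (v.u - σ))
    (hp : α * v.ρ * (v.u - σ) * (v'.u - v.u) + (α' * v'.relPressure E a - α * v.relPressure E a)
      = π₁ * (α' - α)) :
    RankineHugoniot E a π₁ σ (α, v) (α', v') where
  mass := hm
  momentum := by linear_combination hp + v'.u * hm
  entropy := by simp only [hs]; linear_combination v.s * hm
  rel := by simp only [hrel]; linear_combination v.rel * hm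

/-- With `s` and `rel` continuous, `π` is affine in `τ`, and `ℰ` depends on `π` only through
`π²/(2a²)`. The relations `α (u - σ) = m τ` on both sides, with `m` the common mass flux, together
with the momentum relation times `σ`, leave only quadratic terms in the relative velocity and in
`aτ`. -/
theorem energyDefect_of_transported {E : EOS} {a π₁ σ α α' : ℝ} {v v' : PhaseState} (ha : 0 < a)
    (hρ : 0 < v.ρ) (hρ' : 0 < v'.ρ) (hs : v'.s = v.s) (hrel : v'.rel = v.rel)
    (hm : α' * v'.ρ * (v'.u - σ) = α * v.ρ * (v.u - σ))
    (hp : α * v.ρ * (v.u - σ) * (v'.u - v.u) + (α' * v'.relPressure E a - α * v.relPressure E a)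
      = π₁ * (α' - α)) :
    energyDefect E a σ π₁ σ (α, v) (α', v') = α * v.ρ * (v.u - σ) / 2 *
      (((v'.u - σ) ^ 2 - (a * v'.τ) ^ 2) - ((v.u - σ) ^ 2 - (a * v.τ) ^ 2)) := by
  have hπ := relPressure_sub_of_eq (E := E) (a := a) hs hrel
  have hw : α * (v.u - σ) = α * v.ρ * (v.u - σ) * v.τ := by
    unfold PhaseState.τ; field_simp
  have hw' : α' * (v'.u - σ) = α * v.ρ * (v.u - σ) * v'.τ := by
    rw [← hm]; unfold PhaseState.τ; field_simp
  simp only [energyDefect, PhaseState.relEnergy, hs, hrel]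
  set m := α * v.ρ * (v.u - σ) with hmdef
  set p := v.relPressure E a
  set p' := v'.relPressure E a
  set e := E.energy v.rel v.s
  set P := E.pressure v.rel v.s
  have h1 : p' = p + a ^ 2 * (v.τ - v'.τ) := by linarith
  have hd : (p' ^ 2 - P ^ 2) / (2 * a ^ 2) = (p ^ 2 - P ^ 2) / (2 * a ^ 2)
      + p * (v.τ - v'.τ) + a ^ 2 * (v.τ - v'.τ) ^ 2 / 2 := by
    rw [h1]; field_simp; ring
  rw [hd]
  set X := (p ^ 2 - P ^ 2) / (2 * a ^ 2)
  linear_combination (v'.u ^ 2 / 2 + e + (X + p * (v.τ - v'.τ) + a ^ 2 * (v.τ - v'.τ) ^ 2 / 2)) * hm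
    + σ * hp + p' * hw' - p * hw + m * v'.τ * h1

/-- The interface work is proportional to the jump of the fraction, so away from the interface `u₂`
may be replaced by the speed of the wave itself. -/
theorem energyDefect_eq_of_eq_frac {E : EOS} {a u₂ π₁ σ α : ℝ} {v v' : PhaseState} :
    energyDefect E a u₂ π₁ σ (α, v) (α, v') = energyDefect E a σ π₁ σ (α, v) (α, v') := by
  simp [energyDefect]

/-- Acoustic waves: both sides have the same value `σ` of the eigenvalue `u + ε a τ`, `ε = ±1`. -/
theorem acoustic_wave {E : EOS} {a u₂ π₁ σ α ε : ℝ} {v v' : PhaseState} (ha : 0 < a)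
    (hε : ε ^ 2 = 1) (hρ : 0 < v.ρ) (hρ' : 0 < v'.ρ) (hs : v'.s = v.s) (hrel : v'.rel = v.rel)
    (hv : v.u + ε * a * v.τ = σ) (hv' : v'.u + ε * a * v'.τ = σ) :
    RankineHugoniot E a π₁ σ (α, v) (α, v') ∧
      energyDefect E a u₂ π₁ σ (α, v) (α, v') = 0 := by
  have hπ := relPressure_sub_of_eq (E := E) (a := a) hs hrel
  have h1 : v.ρ * v.τ = 1 := mul_inv_cancel₀ hρ.ne'
  have h1' : v'.ρ * v'.τ = 1 := mul_inv_cancel₀ hρ'.ne'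
  have hw : v.u - σ = -(ε * a * v.τ) := by linarith
  have hw' : v'.u - σ = -(ε * a * v'.τ) := by linarith
  -- The mass flux through an acoustic wave does not depend on the state.
  have hm0 : α * v.ρ * (v.u - σ) = -(α * ε * a) := by
    rw [hw]; linear_combination -(α * ε * a) * h1
  have hm : α * v'.ρ * (v'.u - σ) = α * v.ρ * (v.u - σ) := by
    rw [hm0, hw']; linear_combination -(α * ε * a) * h1'
  have hp : α * v.ρ * (v.u - σ) * (v'.u - v.u)
      + (α * v'.relPressure E a - α * v.relPressure E a) = π₁ * (α - α) := by
    rw [hm0]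
    linear_combination α * hπ - α * ε * a * (hv' - hv) + α * a ^ 2 * (v'.τ - v.τ) * hε
  refine ⟨.of_transported hs hrel hm hp, ?_⟩
  rw [energyDefect_eq_of_eq_frac, energyDefect_of_transported ha hρ hρ' hs hrel hm hp, hw, hw']
  linear_combination (α * v.ρ * -(ε * a * v.τ) / 2) * a ^ 2 * (v'.τ ^ 2 - v.τ ^ 2) * hε

/-- Contact discontinuities: both velocities equal the speed. -/
theorem contact_wave {E : EOS} {a u₂ π₁ σ α α' : ℝ} {v v' : PhaseState} (hv : v.u = σ)
    (hv' : v'.u = σ)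
    (hp : α' * v'.relPressure E a - α * v.relPressure E a = π₁ * (α' - α))
    (hσ : σ = u₂ ∨ α' = α) :
    RankineHugoniot E a π₁ σ (α, v) (α', v') ∧
      energyDefect E a u₂ π₁ σ (α, v) (α', v') = 0 := by
  refine ⟨⟨by simp [hv, hv'], by simpa [hv, hv'] using hp, by simp [hv, hv'],
    by simp [hv, hv']⟩, ?_⟩
  simp only [energyDefect, hv, hv', sub_self, mul_zero, zero_add]
  rcases hσ with rfl | rfl
  · linear_combination σ * hp
  · linear_combination σ * hp

/-- The phase state with specific volume `τ`, velocity `u`, and the entropy and relaxation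
unknown of `v`. -/
def PhaseState.moved (v : PhaseState) (τ u : ℝ) : PhaseState := ⟨τ⁻¹, u, v.s, v.rel⟩

namespace PhaseState

variable (v : PhaseState) (τ u : ℝ)

@[simp] theorem moved_u : (v.moved τ u).u = u := rfl
@[simp] theorem moved_s : (v.moved τ u).s = v.s := rfl
@[simp] theorem moved_rel : (v.moved τ u).rel = v.rel := rfl
@[simp] theorem moved_ρ : (v.moved τ u).ρ = τ⁻¹ := rfl
@[simp] theorem moved_τ : (v.moved τ u).τ = τ := inv_inv τ

variable {v τ}

theorem Admissible.moved {E : EOS} (h : v.Admissible E) (hτ : 0 < τ) (u : ℝ) :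
    (v.moved τ u).Admissible E :=
  ⟨inv_pos.2 hτ, h.2⟩

theorem relPressure_moved (E : EOS) (a : ℝ) :
    (v.moved τ u).relPressure E a = v.relPressure E a + a ^ 2 * (v.τ - τ) := by
  simp only [relPressure, moved_τ, moved_s, moved_rel]
  ring

theorem eigenvalue_zero (a : ℝ) (v : PhaseState) : v.eigenvalue a 0 = v.u - a * v.τ := rfl
theorem eigenvalue_one (a : ℝ) (v : PhaseState) : v.eigenvalue a 1 = v.u := rfl
theorem eigenvalue_two (a : ℝ) (v : PhaseState) : v.eigenvalue a 2 = v.u + a * v.τ := rfl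

end PhaseState

/-! ### One phase with velocity equal to that of the phase fraction wave -/

/-- Jumps of a phase whose material contact discontinuity is carried by the phase fraction wave,
of speed `x`. -/
def contactJumps (a αL αR : ℝ) (vL vR : PhaseState) (x : ℝ) : List (ℝ × (ℝ × PhaseState)) :=
  [(vL.u - a * vL.τ, (αL, vL.moved (vL.τ + (x - vL.u) / a) x)),
    (x, (αR, vR.moved (vR.τ - (x - vR.u) / a) x)),
    (vR.u + a * vR.τ, (αR, vR))]

section Contact

variable {E : EOS} {a αL αR x π₁ : ℝ} {vL vR : PhaseState}

theorem contact_left_lt (ha : 0 < a) (hτL : 0 < vL.τ + (x - vL.u) / a) :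
    vL.u - a * vL.τ < x := by
  have h : a * (vL.τ + (x - vL.u) / a) = a * vL.τ + (x - vL.u) := by field_simp
  linarith [mul_pos ha hτL]

theorem contact_lt_right (ha : 0 < a) (hτR : 0 < vR.τ - (x - vR.u) / a) :
    x < vR.u + a * vR.τ := by
  have h : a * (vR.τ - (x - vR.u) / a) = a * vR.τ - (x - vR.u) := by field_simp
  linarith [mul_pos ha hτR]

theorem contactJumps_sorted (ha : 0 < a) (hτL : 0 < vL.τ + (x - vL.u) / a)
    (hτR : 0 < vR.τ - (x - vR.u) / a) : SpeedsSorted (contactJumps a αL αR vL vR x) := by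
  have h1 := contact_left_lt ha hτL
  have h2 := contact_lt_right ha hτR
  refine List.pairwise_cons.2 ⟨?_, List.pairwise_cons.2 ⟨?_, List.pairwise_singleton _ _⟩⟩
  · simpa using ⟨by linarith, by linarith⟩
  · simpa using h2.le

theorem contactFan_frac (ha : 0 < a) (hτL : 0 < vL.τ + (x - vL.u) / a)
    (hτR : 0 < vR.τ - (x - vR.u) / a) (ξ : ℝ) :
    (fan (αL, vL) (contactJumps a αL αR vL vR x) ξ).1 = if ξ < x then αL else αR := by
  have h1 := contact_left_lt ha hτL
  have h2 := contact_lt_right ha hτR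
  simp only [fan, contactJumps]
  split_ifs <;> first | rfl | (exfalso; linarith)

theorem contactFan_admissible (hL : vL.Admissible E) (hR : vR.Admissible E)
    (hτL : 0 < vL.τ + (x - vL.u) / a) (hτR : 0 < vR.τ - (x - vR.u) / a) (ξ : ℝ) :
    (fan (αL, vL) (contactJumps a αL αR vL vR x) ξ).2.Admissible E := by
  refine forall_fan (P := fun w : ℝ × PhaseState => w.2.Admissible E) hL ?_ ξ
  simp [contactJumps, hL.moved hτL, hR.moved hτR, hR]

/-- The factors `π_L - a (x - u_L)` and `π_R + a (x - u_R)` in `hp` are the pressures behind the two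
acoustic waves once the velocity there is `x`. So `hp` is the momentum jump across the interface. No
mass crosses the interface, hence no dissipation. -/
theorem contactFan_phaseEquations (ha : 0 < a) (hL : 0 < vL.ρ) (hR : 0 < vR.ρ)
    (hτL : 0 < vL.τ + (x - vL.u) / a) (hτR : 0 < vR.τ - (x - vR.u) / a)
    (hp : αR * (vR.relPressure E a + a * (x - vR.u))
      - αL * (vL.relPressure E a - a * (x - vL.u)) = π₁ * (αR - αL)) :
    PhaseEquations E a x π₁ 0
      (fun ξ => (fan (αL, vL) (contactJumps a αL αR vL vR x) ξ).1)
      (fun ξ => (fan (αL, vL) (contactJumps a αL αR vL vR x) ξ).2) := by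
  have j1 := acoustic_wave (E := E) (u₂ := x) (π₁ := π₁) (α := αL) (ε := -1)
    (σ := vL.u - a * vL.τ) (v := vL)
    (v' := vL.moved (vL.τ + (x - vL.u) / a) x) ha (by norm_num) hL (inv_pos.2 hτL) rfl rfl
    (by ring) (by simp; field_simp; ring)
  have j3 := acoustic_wave (E := E) (u₂ := x) (π₁ := π₁) (α := αR) (ε := 1)
    (σ := vR.u + a * vR.τ) (v := vR.moved (vR.τ - (x - vR.u) / a) x)
    (v' := vR) ha (by norm_num) (inv_pos.2 hτR) hR rfl rfl
    (by simp; field_simp; ring) (by ring)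
  have j2 := contact_wave (E := E) (a := a) (u₂ := x) (π₁ := π₁) (α := αL) (α' := αR) (σ := x)
    (v := vL.moved (vL.τ + (x - vL.u) / a) x) (v' := vR.moved (vR.τ - (x - vR.u) / a) x) rfl rfl
    (by
      rw [PhaseState.relPressure_moved, PhaseState.relPressure_moved, ← hp]
      field_simp
      ring) (.inl rfl)
  refine phaseEquations_fan (contactJumps_sorted ha hτL hτR) ⟨j1.1, j2.1, j3.1, trivial⟩
    fun δ => ?_
  simp [jumpSum, contactJumps, j1.2, j2.2, j3.2]

theorem contactFan_eigenvalue (ha : 0 < a) (hτL : 0 < vL.τ + (x - vL.u) / a)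
    (hτR : 0 < vR.τ - (x - vR.u) / a) (j : Fin 3) :
    ∀ᶠ η in 𝓝[≠] (![vL.u - a * vL.τ, x, vR.u + a * vR.τ] j),
      (fan (αL, vL) (contactJumps a αL αR vL vR x) η).2.eigenvalue a j
        = ![vL.u - a * vL.τ, x, vR.u + a * vR.τ] j := by
  have h1 := contact_left_lt ha hτL
  have h2 := contact_lt_right ha hτR
  refine eventually_nhdsWithin_of_eventually_nhds ?_
  fin_cases j
  · filter_upwards [eventually_lt_nhds h1] with η hη
    by_cases h : η < vL.u - a * vL.τ <;>
      simp [fan, contactJumps, h, hη, PhaseState.eigenvalue_zero]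
    field_simp
    ring
  · filter_upwards [eventually_gt_nhds h1, eventually_lt_nhds h2] with η hη hη'
    by_cases h : η < x <;>
      simp [fan, contactJumps, h, hη', not_lt.2 hη.le, PhaseState.eigenvalue_one]
  · filter_upwards [eventually_gt_nhds h2] with η hη
    by_cases h : η < vR.u + a * vR.τ <;>
      simp [fan, contactJumps, h, not_lt.2 hη.le, not_lt.2 (h1.trans hη).le,
        PhaseState.eigenvalue_two]
    field_simp
    ring

theorem contactFan_eventually_eq {ξ : ℝ}
    (h : ∀ j, ξ ≠ ![vL.u - a * vL.τ, x, vR.u + a * vR.τ] j) :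
    ∀ᶠ η in 𝓝 ξ, fan (αL, vL) (contactJumps a αL αR vL vR x) η
      = fan (αL, vL) (contactJumps a αL αR vL vR x) ξ := by
  refine fan_eventually_eq ?_
  have h0 := h 0
  have h1 := h 1
  have h2 := h 2
  simp at h0 h1 h2
  simp [contactJumps, h0, h1, h2]

theorem contactFan_left {ξ : ℝ} (h : ξ < vL.u - a * vL.τ) :
    fan (αL, vL) (contactJumps a αL αR vL vR x) ξ = (αL, vL) := by
  simp [fan, contactJumps, h]

theorem contactFan_right {ξ : ℝ} (ha : 0 < a) (hτL : 0 < vL.τ + (x - vL.u) / a)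
    (hτR : 0 < vR.τ - (x - vR.u) / a) (h : vR.u + a * vR.τ < ξ) :
    fan (αL, vL) (contactJumps a αL αR vL vR x) ξ = (αR, vR) := by
  have h1 := contact_left_lt ha hτL
  have h2 := contact_lt_right ha hτR
  simp [fan, contactJumps, not_lt.2 h.le, not_lt.2 (h2.trans h).le,
    not_lt.2 ((h1.trans h2).trans h).le]

end Contact

/-! ### Relations between the data and the sharp quantities -/

section Sharp

variable {E : Fin 2 → EOS} {a : Fin 2 → ℝ} {WL WR : State} {k : Fin 2}

theorem mul_tauSharpL (ha : 0 < a k) :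
    a k * tauSharpL E a WL WR k
      = a k * (WL.phase k).τ + (uSharp E a WL WR k - (WL.phase k).u) := by
  unfold tauSharpL; field_simp

theorem mul_tauSharpR (ha : 0 < a k) :
    a k * tauSharpR E a WL WR k
      = a k * (WR.phase k).τ - (uSharp E a WL WR k - (WR.phase k).u) := by
  unfold tauSharpR; field_simp

/-- The pair `(u♯, π♯)` is the middle state of the Riemann problem for a single phase: `π + a u`
keeps its left value and `π - a u` its right value. -/
theorem relPressure_left_eq (ha : 0 < a k) :
    (WL.phase k).relPressure (E k) (a k)
      = piSharp E a WL WR k + a k * (uSharp E a WL WR k - (WL.phase k).u) := by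
  unfold piSharp uSharp; field_simp; ring

theorem relPressure_right_eq (ha : 0 < a k) :
    (WR.phase k).relPressure (E k) (a k)
      = piSharp E a WL WR k - a k * (uSharp E a WL WR k - (WR.phase k).u) := by
  unfold piSharp uSharp; field_simp; ring

/-- Used to express the specific volume behind an acoustic wave through the sharp quantities, in
which the positivity conditions are stated. -/
theorem tau_left_add (ha : 0 < a k) (x : ℝ) :
    (WL.phase k).τ + (x - (WL.phase k).u) / a k
      = tauSharpL E a WL WR k + (x - uSharp E a WL WR k) / a k := by
  unfold tauSharpL; field_simp; ring

theorem tau_right_sub (ha : 0 < a k) (x : ℝ) :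
    (WR.phase k).τ - (x - (WR.phase k).u) / a k
      = tauSharpR E a WL WR k - (x - uSharp E a WL WR k) / a k := by
  unfold tauSharpR; field_simp; ring

theorem frac_one_eq (W : State) : W.frac 1 = 1 - W.frac 0 := rfl

theorem State.Admissible.frac_pos {W : State} (h : W.Admissible E) (k : Fin 2) :
    0 < W.frac k := by
  fin_cases k
  · exact h.1
  · exact sub_pos.2 h.2.1

end Sharp

/-! ### Phase 2 and the full solution -/

theorem distDx_step {φ : ℝ × ℝ → ℝ} (h : IsTest φ) (c A B : ℝ) :
    distDx (fun ξ => if ξ < c then A else B) φ = (B - A) * dirac c φ := by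
  simpa [fan, jumpSum] using
    distDx_fan h (fun x : ℝ => x) A (l := [(c, B)]) (List.pairwise_singleton _ _)

theorem distDt_step {φ : ℝ × ℝ → ℝ} (h : IsTest φ) (c A B : ℝ) :
    distDt (fun ξ => if ξ < c then A else B) φ = (A - B) * (c * dirac c φ) := by
  simpa [fan, jumpSum] using
    distDt_fan h (fun x : ℝ => x) A (l := [(c, B)]) (List.pairwise_singleton _ _)

theorem IsPhaseOneSolution.exists_isSubsonicSolution {E : Fin 2 → EOS} {a : Fin 2 → ℝ}
    {WL WR : State} {v : ℝ → PhaseState} {u₂ π₁ Q : ℝ} (ha : ∀ k, 0 < a k)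
    (hL : WL.Admissible E) (hR : WR.Admissible E) (hv : IsPhaseOneSolution E a WL WR v u₂ π₁ Q)
    (hB : ConditionB E a WL WR u₂) :
    ∃ W : ℝ → State, IsSubsonicSolution E a WL WR W u₂ π₁ Q ∧ ∀ ξ, (W ξ).phase 0 = v ξ := by
  have ha1 := ha 1
  have hτL : 0 < (WL.phase 1).τ + (u₂ - (WL.phase 1).u) / a 1 := by
    rw [tau_left_add (E := E) (WR := WR) ha1]
    have : 0 < (a 1 * tauSharpL E a WL WR 1 + (u₂ - uSharp E a WL WR 1)) / a 1 :=
      div_pos (by linarith [hB.1]) ha1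
    rwa [add_div, mul_div_cancel_left₀ _ ha1.ne'] at this
  have hτR : 0 < (WR.phase 1).τ - (u₂ - (WR.phase 1).u) / a 1 := by
    rw [tau_right_sub (E := E) (WL := WL) ha1]
    have : 0 < (a 1 * tauSharpR E a WL WR 1 - (u₂ - uSharp E a WL WR 1)) / a 1 :=
      div_pos (by linarith [hB.2]) ha1
    rwa [sub_div, mul_div_cancel_left₀ _ ha1.ne'] at this
  set l := contactJumps (a 1) (WL.frac 1) (WR.frac 1) (WL.phase 1) (WR.phase 1) u₂ with hl
  set z := fan (WL.frac 1, WL.phase 1) l with hz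
  have hfrac : ∀ ξ, (z ξ).1 = if ξ < u₂ then WL.frac 1 else WR.frac 1 :=
    contactFan_frac ha1 hτL hτR
  set W : ℝ → State := fun ξ =>
    ⟨if ξ < u₂ then WL.α₁ else WR.α₁, ![v ξ, (z ξ).2]⟩ with hW
  have hW0 : ∀ ξ, (W ξ).frac 0 = if ξ < u₂ then WL.frac 0 else WR.frac 0 := fun ξ => rfl
  have hW1 : ∀ ξ, (W ξ).frac 1 = if ξ < u₂ then WL.frac 1 else WR.frac 1 := fun ξ => by
    by_cases h : ξ < u₂ <;> simp [hW, State.frac, h]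
  have hWk : ∀ k ξ, (W ξ).frac k = if ξ < u₂ then WL.frac k else WR.frac k := by
    intro k
    fin_cases k
    · exact hW0
    · exact hW1
  have hsl := hv.subsonic_left
  have hsr := hv.subsonic_right
  refine ⟨W, ?_, fun ξ => rfl⟩
  obtain ⟨σ, hσ, hσ'⟩ := hv.contacts
  refine ⟨fun ξ => ⟨?_, ?_, fun k => ?_⟩, ⟨![σ, ![(WL.phase 1).u - a 1 * (WL.phase 1).τ, u₂,
    (WR.phase 1).u + a 1 * (WR.phase 1).τ]], rfl, fun ξ hξ => ?_, fun k j => ?_⟩,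
    fun ξ hξ => ?_, fun ξ hξ => ?_, fun k φ hφ => ?_, fun k φ hφ => ?_, ?_, ?_,
    hv.dissipation, hsl, hsr⟩
  · change 0 < if ξ < u₂ then WL.α₁ else WR.α₁
    split_ifs
    exacts [hL.1, hR.1]
  · change (if ξ < u₂ then WL.α₁ else WR.α₁) < 1
    split_ifs
    exacts [hL.2.1, hR.2.1]
  · fin_cases k
    · exact hv.admissible ξ
    · exact contactFan_admissible (hL.2.2 1) (hR.2.2 1) hτL hτR ξ
  · have h1 := hσ ξ (hξ 1 1) (fun j => hξ 0 j)
    have h2 : ∀ᶠ η in 𝓝 ξ, z η = z ξ := contactFan_eventually_eq fun j => hξ 1 j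
    have h3 : ∀ᶠ η in 𝓝 ξ, (η < u₂ ↔ ξ < u₂) := by
      rcases lt_or_gt_of_ne (hξ 1 1 : ξ ≠ u₂) with h | h
      · filter_upwards [eventually_lt_nhds h] with η hη
        exact iff_of_true hη h
      · filter_upwards [eventually_gt_nhds h] with η hη
        exact iff_of_false (not_lt.2 hη.le) (not_lt.2 h.le)
    filter_upwards [h1, h2, h3] with η h1 h2 h3
    simp only [hW, h1, h2, h3]
  · fin_cases k
    · exact hσ' j
    · exact contactFan_eigenvalue ha1 hτL hτR j
  · have h1 := hv.left_state ξ (hξ 0)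
    have h2 : z ξ = (WL.frac 1, WL.phase 1) := contactFan_left (hξ 1)
    have h3 : ξ < u₂ := (hξ 0).trans hsl
    simp only [hW, h1, h2, h3, if_true]
    obtain ⟨α, p⟩ := WL
    congr 1
    funext k
    fin_cases k <;> rfl
  · have h1 := hv.right_state ξ (hξ 0)
    have h2 : z ξ = (WR.frac 1, WR.phase 1) := contactFan_right ha1 hτL hτR (hξ 1)
    have h3 : ¬ ξ < u₂ := not_lt.2 (hsr.trans (hξ 0)).le
    simp only [hW, h1, h2, h3, if_false]
    obtain ⟨α, p⟩ := WR
    congr 1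
    funext k
    fin_cases k <;> rfl
  · simp only [hWk]
    rw [distDt_step hφ, distDx_step hφ]
    ring
  · simp only [hWk]
    rw [distDx_step hφ]
  · simp only [hW0]
    exact hv.equations
  · have h1 : (fun ξ => (W ξ).frac 1) = fun ξ => (z ξ).1 := by
      funext ξ
      rw [hW1, hfrac]
    rw [h1]
    -- Written with the sharp quantities, the momentum jump of phase 2 at the interface is the
    -- coupling relation, because the jumps of the two fractions are opposite.
    refine contactFan_phaseEquations ha1 (hL.2.2 1).1 (hR.2.2 1).1 hτL hτR ?_
    have hc := hv.coupling
    rw [relPressure_left_eq (WL := WL) (WR := WR) ha1,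
      relPressure_right_eq (WL := WL) (WR := WR) ha1]
    rw [frac_one_eq WL, frac_one_eq WR] at hc ⊢
    linear_combination hc

/-! ### Coupled phase 1 solutions with a material contact carried by the interface -/

/-- The degenerate wave pattern in which no phase 1 mass crosses the interface: `hc` is the momentum
balance imposed by phase 2, `hp` that of phase 1. -/
theorem exists_isPhaseOneSolution_of_contact {E : Fin 2 → EOS} {a : Fin 2 → ℝ}
    {WL WR : State} {u₂ π₁ : ℝ} (ha : 0 < a 0) (hL : WL.Admissible E) (hR : WR.Admissible E)
    (hτL : 0 < a 0 * tauSharpL E a WL WR 0 + (u₂ - uSharp E a WL WR 0))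
    (hτR : 0 < a 0 * tauSharpR E a WL WR 0 - (u₂ - uSharp E a WL WR 0))
    (hc : (WR.frac 0 - WL.frac 0) * π₁ = (WR.frac 0 - WL.frac 0) * piSharp E a WL WR 1
      - a 1 * (WR.frac 1 + WL.frac 1) * (u₂ - uSharp E a WL WR 1))
    (hp : (WR.frac 0 - WL.frac 0) * π₁ = (WR.frac 0 - WL.frac 0) * piSharp E a WL WR 0
      + a 0 * (WR.frac 0 + WL.frac 0) * (u₂ - uSharp E a WL WR 0)) :
    ∃ v, IsPhaseOneSolution E a WL WR v u₂ π₁ 0 := by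
  have hτL' : 0 < (WL.phase 0).τ + (u₂ - (WL.phase 0).u) / a 0 := by
    rw [tau_left_add (E := E) (WR := WR) ha]
    have := div_pos hτL ha
    rwa [add_div, mul_div_cancel_left₀ _ ha.ne'] at this
  have hτR' : 0 < (WR.phase 0).τ - (u₂ - (WR.phase 0).u) / a 0 := by
    rw [tau_right_sub (E := E) (WL := WL) ha]
    have := div_pos hτR ha
    rwa [sub_div, mul_div_cancel_left₀ _ ha.ne'] at this
  refine ⟨fun ξ => (fan (WL.frac 0, WL.phase 0)
    (contactJumps (a 0) (WL.frac 0) (WR.frac 0) (WL.phase 0) (WR.phase 0) u₂) ξ).2,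
    contactFan_admissible (hL.2.2 0) (hR.2.2 0) hτL' hτR', ⟨_, fun ξ _ hξ => ?_,
    contactFan_eigenvalue ha hτL' hτR'⟩, fun ξ hξ => ?_, fun ξ hξ => ?_, ?_, hc, le_rfl,
    contact_left_lt ha hτL', contact_lt_right ha hτR'⟩
  · exact (contactFan_eventually_eq hξ).mono fun η h => by rw [h]
  · rw [contactFan_left hξ]
  · rw [contactFan_right ha hτL' hτR' hξ]
  · simp only [← contactFan_frac (αL := WL.frac 0) (αR := WR.frac 0) ha hτL' hτR']
    refine contactFan_phaseEquations ha (hL.2.2 0).1 (hR.2.2 0).1 hτL' hτR' ?_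
    rw [relPressure_left_eq (WL := WL) (WR := WR) ha,
      relPressure_right_eq (WL := WL) (WR := WR) ha]
    linear_combination -hp

/-! ### Coupled phase 1 solutions with four separated waves -/

/-- The jump of a phase across the phase fraction wave, with its dissipation. -/
theorem interface_wave {E : EOS} {a π₁ σ α α' Q : ℝ} {v v' : PhaseState} (ha : 0 < a)
    (hρ : 0 < v.ρ) (hρ' : 0 < v'.ρ) (hs : v'.s = v.s) (hrel : v'.rel = v.rel)
    (hm : α' * v'.ρ * (v'.u - σ) = α * v.ρ * (v.u - σ))
    (hp : α * v.ρ * (v.u - σ) * (v'.u - v.u) + (α' * v'.relPressure E a - α * v.relPressure E a)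
      = π₁ * (α' - α))
    (hQ : Q = α * v.ρ * (v.u - σ) / 2 *
      (((v.u - σ) ^ 2 - (a * v.τ) ^ 2) - ((v'.u - σ) ^ 2 - (a * v'.τ) ^ 2))) :
    RankineHugoniot E a π₁ σ (α, v) (α', v') ∧
      energyDefect E a σ π₁ σ (α, v) (α', v') = -Q := by
  refine ⟨.of_transported hs hrel hm hp, ?_⟩
  rw [energyDefect_of_transported ha hρ hρ' hs hrel hm hp, hQ]
  ring

/-- A phase 1 fan with four waves, one of which is the phase fraction wave. -/
theorem isPhaseOneSolution_of_four_waves {E : Fin 2 → EOS} {a : Fin 2 → ℝ} {WL WR : State}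
    {u₂ π₁ Q s₁ s₂ s₃ s₄ α : ℝ} {v₁ v₂ v₃ : PhaseState}
    (hL : WL.Admissible E) (hR : WR.Admissible E)
    (hs₁ : s₁ = (WL.phase 0).u - a 0 * (WL.phase 0).τ)
    (hs₄ : s₄ = (WR.phase 0).u + a 0 * (WR.phase 0).τ)
    (h₁₂ : s₁ < s₂) (h₂₃ : s₂ < s₃) (h₃₄ : s₃ < s₄)
    (h₁ : v₁.Admissible (E 0)) (h₂ : v₂.Admissible (E 0)) (h₃ : v₃.Admissible (E 0))
    (he₁ : v₁.u - a 0 * v₁.τ = s₁) (he₃ : v₃.u + a 0 * v₃.τ = s₄)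
    (hα : (u₂ = s₂ ∧ α = WR.frac 0 ∧ v₂.u = s₃ ∧ v₃.u = s₃) ∨
      (u₂ = s₃ ∧ α = WL.frac 0 ∧ v₁.u = s₂ ∧ v₂.u = s₂))
    (hj₁ : RankineHugoniot (E 0) (a 0) π₁ s₁ (WL.frac 0, WL.phase 0) (WL.frac 0, v₁) ∧
      energyDefect (E 0) (a 0) u₂ π₁ s₁ (WL.frac 0, WL.phase 0) (WL.frac 0, v₁) = 0)
    (hj₂ : RankineHugoniot (E 0) (a 0) π₁ s₂ (WL.frac 0, v₁) (α, v₂))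
    (hj₃ : RankineHugoniot (E 0) (a 0) π₁ s₃ (α, v₂) (WR.frac 0, v₃))
    (hj₄ : RankineHugoniot (E 0) (a 0) π₁ s₄ (WR.frac 0, v₃) (WR.frac 0, WR.phase 0) ∧
      energyDefect (E 0) (a 0) u₂ π₁ s₄ (WR.frac 0, v₃) (WR.frac 0, WR.phase 0) = 0)
    (hd : ∀ δ : ℝ → ℝ, energyDefect (E 0) (a 0) u₂ π₁ s₂ (WL.frac 0, v₁) (α, v₂) * δ s₂
      + energyDefect (E 0) (a 0) u₂ π₁ s₃ (α, v₂) (WR.frac 0, v₃) * δ s₃ = -Q * δ u₂)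
    (hc : (WR.frac 0 - WL.frac 0) * π₁ = (WR.frac 0 - WL.frac 0) * piSharp E a WL WR 1
      - a 1 * (WR.frac 1 + WL.frac 1) * (u₂ - uSharp E a WL WR 1))
    (hQ : 0 ≤ Q) :
    ∃ v, IsPhaseOneSolution E a WL WR v u₂ π₁ Q := by
  set l : List (ℝ × (ℝ × PhaseState)) := [(s₁, (WL.frac 0, v₁)), (s₂, (α, v₂)),
    (s₃, (WR.frac 0, v₃)), (s₄, (WR.frac 0, WR.phase 0))] with hl
  have hsort : SpeedsSorted l := by
    simp only [SpeedsSorted, hl, List.pairwise_cons, List.mem_cons, List.not_mem_nil, or_false,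
      forall_eq_or_imp, forall_eq, List.Pairwise.nil, and_true, IsEmpty.forall_iff, implies_true]
    refine ⟨⟨?_, ?_, ?_⟩, ⟨?_, ?_⟩, ?_⟩ <;> linarith
  have hfrac : ∀ ξ, (if ξ < u₂ then WL.frac 0 else WR.frac 0)
      = (fan (WL.frac 0, WL.phase 0) l ξ).1 := by
    intro ξ
    simp only [fan, hl]
    rcases hα with ⟨rfl, rfl, -⟩ | ⟨rfl, rfl, -⟩ <;> split_ifs <;>
      first | rfl | (exfalso; linarith)
  -- The material contact is whichever of the two middle waves is not the interface.
  set σ : Fin 3 → ℝ := ![s₁, if u₂ = s₂ then s₃ else s₂, s₄] with hσ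
  have hσu : σ 1 = s₂ ∧ u₂ = s₃ ∧ v₁.u = s₂ ∧ v₂.u = s₂ ∨
      σ 1 = s₃ ∧ u₂ = s₂ ∧ v₂.u = s₃ ∧ v₃.u = s₃ := by
    rcases hα with ⟨h, -, h'⟩ | ⟨h, -, h'⟩
    · exact .inr ⟨by simp [hσ, h], h, h'⟩
    · exact .inl ⟨by simp [hσ, h, h₂₃.ne'], h, h'⟩
  refine ⟨fun ξ => (fan (WL.frac 0, WL.phase 0) l ξ).2, fun ξ => ?_, ⟨σ, fun ξ hu hξ => ?_,
    fun j => ?_⟩, fun ξ hξ => ?_, fun ξ hξ => ?_, ?_, hc, hQ, ?_, ?_⟩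
  · refine forall_fan (P := fun w : ℝ × PhaseState => w.2.Admissible (E 0)) (hL.2.2 0) ?_ ξ
    simp [hl, h₁, h₂, h₃, hR.2.2 0]
  · have h : ∀ᶠ η in 𝓝 ξ, fan (WL.frac 0, WL.phase 0) l η = fan (WL.frac 0, WL.phase 0) l ξ := by
      refine fan_eventually_eq ?_
      have e0 : ξ ≠ s₁ := hξ 0
      have e2 : ξ ≠ s₄ := hξ 2
      have e1 := hξ 1
      rcases hσu with ⟨h, h', -⟩ | ⟨h, h', -⟩ <;> rw [h] at e1 <;> rw [h'] at hu <;>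
        simp [hl, e0, e1, e2, hu]
    exact h.mono fun η h => by rw [h]
  · refine eventually_nhdsWithin_of_eventually_nhds ?_
    fin_cases j
    · change ∀ᶠ η in 𝓝 s₁, (fan (WL.frac 0, WL.phase 0) l η).2.u
        - a 0 * (fan (WL.frac 0, WL.phase 0) l η).2.τ = s₁
      filter_upwards [eventually_lt_nhds h₁₂] with η hη
      by_cases h : η < s₁
      · simp [fan, hl, h, ← hs₁]
      · simp [fan, hl, h, hη, he₁]
    · change ∀ᶠ η in 𝓝 (σ 1), (fan (WL.frac 0, WL.phase 0) l η).2.u = σ 1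
      rcases hσu with ⟨h, -, h', h''⟩ | ⟨h, -, h', h''⟩ <;> rw [h]
      · filter_upwards [eventually_gt_nhds h₁₂, eventually_lt_nhds h₂₃] with η hη hη'
        by_cases h : η < s₂ <;> simp [fan, hl, h, hη', not_lt.2 hη.le, h', h'']
      · filter_upwards [eventually_gt_nhds h₂₃, eventually_lt_nhds h₃₄] with η hη hη'
        by_cases h : η < s₃ <;>
          simp [fan, hl, h, hη', not_lt.2 hη.le, not_lt.2 (h₁₂.trans hη).le, h', h'']
    · change ∀ᶠ η in 𝓝 s₄, (fan (WL.frac 0, WL.phase 0) l η).2.u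
        + a 0 * (fan (WL.frac 0, WL.phase 0) l η).2.τ = s₄
      filter_upwards [eventually_gt_nhds h₃₄] with η hη
      by_cases h : η < s₄
      · simp [fan, hl, h, not_lt.2 hη.le, not_lt.2 (h₂₃.trans hη).le,
          not_lt.2 (h₁₂.trans (h₂₃.trans hη)).le, he₃]
      · simp [fan, hl, h, not_lt.2 hη.le, not_lt.2 (h₂₃.trans hη).le,
          not_lt.2 (h₁₂.trans (h₂₃.trans hη)).le, ← hs₄]
  · rw [← hs₁] at hξ
    simp [fan, hl, hξ]
  · rw [← hs₄] at hξ
    have i3 := h₃₄.trans hξ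
    have i2 := h₂₃.trans i3
    simp [fan, hl, not_lt.2 hξ.le, not_lt.2 i3.le, not_lt.2 i2.le, not_lt.2 (h₁₂.trans i2).le]
  · simp only [hfrac]
    refine phaseEquations_fan hsort ⟨hj₁.1, hj₂, hj₃, hj₄.1, trivial⟩ fun δ => ?_
    simp only [jumpSum, hl, hj₁.2, hj₄.2]
    linear_combination hd δ
  · rw [← hs₁]
    rcases hσu with ⟨-, h, -⟩ | ⟨-, h, -⟩ <;> rw [h] <;> linarith
  · rw [← hs₄]
    rcases hσu with ⟨-, h, -⟩ | ⟨-, h, -⟩ <;> rw [h] <;> linarith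

/-- Dissipation across the phase fraction wave, where `M` and `N` are the Mach numbers relative to
that wave on the side of the incoming and of the outgoing phase. -/
theorem dissipation_nonneg {A c x y M N : ℝ} (hM : M < 1) (hN : 0 < N)
    (hx : M * (A - c + x) = x) (hy : N * (A + c - y) = y)
    (hQ : (A - c) ^ 2 * ((1 + M) * (1 + N)) ≤ (A + c) ^ 2 * ((1 - M) * (1 - N))) :
    0 ≤ (x ^ 2 - (A - c + x) ^ 2) - (y ^ 2 - (A + c - y) ^ 2) := by
  have hpos : 0 < (1 - M) * (1 + N) := by
    have : 0 < 1 - M := by linarith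
    positivity
  refine nonneg_of_mul_nonneg_left (b := (1 - M) * (1 + N)) ?_ hpos
  -- By `hx` and `hy`, `A - c + x = (A - c)/(1 - M)` and `A + c - y = (A + c)/(1 + N)`. Clearing
  -- these denominators turns the claim into `hQ`.
  have h : ((x ^ 2 - (A - c + x) ^ 2) - (y ^ 2 - (A + c - y) ^ 2)) * ((1 - M) * (1 + N))
      = (A + c) ^ 2 * ((1 - M) * (1 - N)) - (A - c) ^ 2 * ((1 + M) * (1 + N)) := by
    linear_combination 2 * (A - c) * (1 + N) * hx + 2 * (A + c) * (1 - M) * hy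
  rw [h]
  linarith

section FourWaves

variable {E : Fin 2 → EOS} {a : Fin 2 → ℝ} {WL WR : State} {u₂ π₁ M N : ℝ}

/-- Wave ordering `u₂ < u₁*`: phase 1 flows through the phase fraction wave from left to right. -/
theorem exists_isPhaseOneSolution_of_rightward (ha : 0 < a 0) (hL : WL.Admissible E)
    (hR : WR.Admissible E) (hM : 0 < M) (hM1 : M < 1) (hN : 0 < N)
    (hMN : WR.frac 0 * N = WL.frac 0 * M)
    (hc0 : u₂ < uSharp E a WL WR 0)
    (hcA : uSharp E a WL WR 0 - u₂ < a 0 * tauSharpL E a WL WR 0)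
    (hcB : N * (a 0 * tauSharpL E a WL WR 0 + (uSharp E a WL WR 0 - u₂))
      < (a 0 * tauSharpR E a WL WR 0 + (uSharp E a WL WR 0 - u₂)) * (1 + N))
    (hQ : (a 0 * tauSharpL E a WL WR 0 - (uSharp E a WL WR 0 - u₂)) ^ 2 * ((1 + M) * (1 + N))
      ≤ (a 0 * tauSharpL E a WL WR 0 + (uSharp E a WL WR 0 - u₂)) ^ 2 * ((1 - M) * (1 - N)))
    (hc : (WR.frac 0 - WL.frac 0) * π₁ = (WR.frac 0 - WL.frac 0) * piSharp E a WL WR 1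
      - a 1 * (WR.frac 1 + WL.frac 1) * (u₂ - uSharp E a WL WR 1))
    (hp : (WR.frac 0 - WL.frac 0) * π₁ = (WR.frac 0 - WL.frac 0) * piSharp E a WL WR 0
      - a 0 * (WR.frac 0 + WL.frac 0) * (uSharp E a WL WR 0 - u₂)
      + 2 * a 0 * WL.frac 0 * M * (a 0 * tauSharpL E a WL WR 0)) :
    ∃ Q v, IsPhaseOneSolution E a WL WR v u₂ π₁ Q := by
  have fA := mul_tauSharpL (E := E) (WL := WL) (WR := WR) ha
  have fB := mul_tauSharpR (E := E) (WL := WL) (WR := WR) ha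
  have fL := relPressure_left_eq (E := E) (WL := WL) (WR := WR) ha
  have fR := relPressure_right_eq (E := E) (WL := WL) (WR := WR) ha
  have hαL := hL.frac_pos 0
  set A := a 0 * tauSharpL E a WL WR 0
  set B := a 0 * tauSharpR E a WL WR 0
  set u := uSharp E a WL WR 0
  obtain ⟨c, hcu⟩ : ∃ c, c = u - u₂ := ⟨_, rfl⟩
  rw [← hcu] at hcA hcB hQ hp
  have hcpos : 0 < c := by linarith
  have h1M : 0 < 1 - M := by linarith
  -- Here `x` and `y` are the velocities relative to the interface before and after crossing it.
  -- They solve `x = M (aτ₋)` and `y = N (aτ₊)`.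
  obtain ⟨x, hx0⟩ : ∃ x, x = M * (A - c) / (1 - M) := ⟨_, rfl⟩
  obtain ⟨y, hy0⟩ : ∃ y, y = N * (A + c) / (1 + N) := ⟨_, rfl⟩
  have hx : M * (A - c + x) = x := by rw [hx0]; field_simp; ring
  have hy : N * (A + c - y) = y := by rw [hy0]; field_simp; ring
  have hxpos : 0 < x := by
    rw [hx0]
    exact div_pos (mul_pos hM (by linarith)) h1M
  have hypos : 0 < y := by
    rw [hy0]
    exact div_pos (mul_pos hN (by linarith)) (by linarith)
  have hyB : y < B + c := by rw [hy0, div_lt_iff₀ (by linarith)]; exact hcB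
  have hyA : 0 < A + c - y := pos_of_mul_pos_right (by rw [hy]; exact hypos) hN.le
  have hxA : 0 < A - c + x := by linarith
  -- The specific volumes are forced: `τm` and `τr` by the invariance of the outer acoustic
  -- eigenvalues, `τp` by equality of pressures across the material contact.
  set τm := (A - c + x) / a 0 with hτm
  set τp := (A + c - y) / a 0 with hτp
  set τr := (B + c - y) / a 0 with hτr
  have tm : 0 < τm := div_pos hxA ha
  have tp : 0 < τp := div_pos hyA ha
  have tr : 0 < τr := div_pos (by linarith) ha
  have em : a 0 * τm = A - c + x := by rw [hτm]; field_simp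
  have ep : a 0 * τp = A + c - y := by rw [hτp]; field_simp
  have er : a 0 * τr = B + c - y := by rw [hτr]; field_simp
  have gm : τm⁻¹ * x = M * a 0 := by
    rw [inv_mul_eq_iff_eq_mul₀ tm.ne']
    linear_combination -hx - M * em
  have gp : τp⁻¹ * y = N * a 0 := by
    rw [inv_mul_eq_iff_eq_mul₀ tp.ne']
    linear_combination -hy - N * ep
  set α := WL.frac 0
  set β := WR.frac 0
  have j1 := acoustic_wave (E := E 0) (u₂ := u₂) (π₁ := π₁) (α := α) (ε := -1)
    (σ := (WL.phase 0).u - a 0 * (WL.phase 0).τ) (v := WL.phase 0)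
    (v' := (WL.phase 0).moved τm (u₂ + x)) ha (by norm_num) (hL.2.2 0).1 (inv_pos.2 tm) rfl rfl
    (by ring) (by simp; linarith)
  have j4 := acoustic_wave (E := E 0) (u₂ := u₂) (π₁ := π₁) (α := β) (ε := 1)
    (σ := (WR.phase 0).u + a 0 * (WR.phase 0).τ) (v := (WR.phase 0).moved τr (u₂ + y))
    (v' := WR.phase 0) ha (by norm_num) (inv_pos.2 tr) (hR.2.2 0).1 rfl rfl
    (by simp; linarith) (by ring)
  have hQ0 := dissipation_nonneg hM1 hN hx hy hQ
  have j2 := interface_wave (E := E 0) (π₁ := π₁) (σ := u₂) (α := α) (α' := β)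
    (Q := α * (M * a 0) / 2 * ((x ^ 2 - (A - c + x) ^ 2) - (y ^ 2 - (A + c - y) ^ 2)))
    (v := (WL.phase 0).moved τm (u₂ + x)) (v' := (WL.phase 0).moved τp (u₂ + y)) ha
    (inv_pos.2 tm) (inv_pos.2 tp) rfl rfl
    (by
      simp only [PhaseState.moved_ρ, PhaseState.moved_u, add_sub_cancel_left, mul_assoc, gm, gp]
      linear_combination a 0 * hMN)
    (by
      simp only [PhaseState.moved_ρ, PhaseState.moved_u, PhaseState.relPressure_moved,
        add_sub_cancel_left, mul_assoc, fL]
      linear_combination -hp + α * (y - x) * gm + a 0 * (β * -hy + (A + c - y) * hMN + α * -hx)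
        - a 0 * (β - α) * fA - a 0 * β * ep + a 0 * α * em)
    (by simp only [PhaseState.moved_ρ, PhaseState.moved_u, PhaseState.moved_τ,
      add_sub_cancel_left, mul_assoc, gm, em, ep])
  have j3 := contact_wave (E := E 0) (a := a 0) (u₂ := u₂) (π₁ := π₁) (α := β) (α' := β)
    (σ := u₂ + y) (v := (WL.phase 0).moved τp (u₂ + y))
    (v' := (WR.phase 0).moved τr (u₂ + y)) rfl rfl
    (by
      simp only [PhaseState.relPressure_moved, fL, fR]
      linear_combination β * a 0 * (fA - fB + ep - er)) (.inr rfl)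
  refine ⟨α * (M * a 0) / 2 * ((x ^ 2 - (A - c + x) ^ 2) - (y ^ 2 - (A + c - y) ^ 2)),
    isPhaseOneSolution_of_four_waves hL hR rfl rfl (s₂ := u₂) (s₃ := u₂ + y)
    (by linarith) (by linarith) (by linarith) ((hL.2.2 0).moved tm _) ((hL.2.2 0).moved tp _)
    ((hR.2.2 0).moved tr _) (by simp; linarith) (by simp; linarith)
    (.inl ⟨rfl, rfl, rfl, rfl⟩) j1 j2.1 j3.1 j4 (fun δ => ?_) hc ?_⟩
  · rw [j2.2, j3.2]
    ring
  · positivity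

/-- Wave ordering `u₁* < u₂`: phase 1 flows through the phase fraction wave from right to left. -/
theorem exists_isPhaseOneSolution_of_leftward (ha : 0 < a 0) (hL : WL.Admissible E)
    (hR : WR.Admissible E) (hM : 0 < M) (hM1 : M < 1) (hN : 0 < N)
    (hMN : WL.frac 0 * N = WR.frac 0 * M)
    (hc0 : uSharp E a WL WR 0 < u₂)
    (hcB : u₂ - uSharp E a WL WR 0 < a 0 * tauSharpR E a WL WR 0)
    (hcA : N * (a 0 * tauSharpR E a WL WR 0 + (u₂ - uSharp E a WL WR 0))
      < (a 0 * tauSharpL E a WL WR 0 + (u₂ - uSharp E a WL WR 0)) * (1 + N))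
    (hQ : (a 0 * tauSharpR E a WL WR 0 - (u₂ - uSharp E a WL WR 0)) ^ 2 * ((1 + M) * (1 + N))
      ≤ (a 0 * tauSharpR E a WL WR 0 + (u₂ - uSharp E a WL WR 0)) ^ 2 * ((1 - M) * (1 - N)))
    (hc : (WR.frac 0 - WL.frac 0) * π₁ = (WR.frac 0 - WL.frac 0) * piSharp E a WL WR 1
      - a 1 * (WR.frac 1 + WL.frac 1) * (u₂ - uSharp E a WL WR 1))
    (hp : (WR.frac 0 - WL.frac 0) * π₁ = (WR.frac 0 - WL.frac 0) * piSharp E a WL WR 0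
      + a 0 * (WR.frac 0 + WL.frac 0) * (u₂ - uSharp E a WL WR 0)
      - 2 * a 0 * WR.frac 0 * M * (a 0 * tauSharpR E a WL WR 0)) :
    ∃ Q v, IsPhaseOneSolution E a WL WR v u₂ π₁ Q := by
  have fA := mul_tauSharpL (E := E) (WL := WL) (WR := WR) ha
  have fB := mul_tauSharpR (E := E) (WL := WL) (WR := WR) ha
  have fL := relPressure_left_eq (E := E) (WL := WL) (WR := WR) ha
  have fR := relPressure_right_eq (E := E) (WL := WL) (WR := WR) ha
  have hαR := hR.frac_pos 0
  set A := a 0 * tauSharpL E a WL WR 0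
  set B := a 0 * tauSharpR E a WL WR 0
  set u := uSharp E a WL WR 0
  obtain ⟨c, hcu⟩ : ∃ c, c = u₂ - u := ⟨_, rfl⟩
  rw [← hcu] at hcA hcB hQ hp
  have hcpos : 0 < c := by linarith
  have h1M : 0 < 1 - M := by linarith
  -- Mirror image of the rightward case: the incoming side is now the right one, so `B` plays the
  -- role of `A`, and the velocities relative to the interface are `-x` and `-y`.
  obtain ⟨x, hx0⟩ : ∃ x, x = M * (B - c) / (1 - M) := ⟨_, rfl⟩
  obtain ⟨y, hy0⟩ : ∃ y, y = N * (B + c) / (1 + N) := ⟨_, rfl⟩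
  have hx : M * (B - c + x) = x := by rw [hx0]; field_simp; ring
  have hy : N * (B + c - y) = y := by rw [hy0]; field_simp; ring
  have hxpos : 0 < x := by
    rw [hx0]
    exact div_pos (mul_pos hM (by linarith)) h1M
  have hypos : 0 < y := by
    rw [hy0]
    exact div_pos (mul_pos hN (by linarith)) (by linarith)
  have hyA : y < A + c := by rw [hy0, div_lt_iff₀ (by linarith)]; exact hcA
  have hyB : 0 < B + c - y := pos_of_mul_pos_right (by rw [hy]; exact hypos) hN.le
  have hxB : 0 < B - c + x := by linarith
  set τp := (B - c + x) / a 0 with hτp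
  set τm := (B + c - y) / a 0 with hτm
  set τl := (A + c - y) / a 0 with hτl
  have tm : 0 < τm := div_pos hyB ha
  have tp : 0 < τp := div_pos hxB ha
  have tl : 0 < τl := div_pos (by linarith) ha
  have em : a 0 * τm = B + c - y := by rw [hτm]; field_simp
  have ep : a 0 * τp = B - c + x := by rw [hτp]; field_simp
  have el : a 0 * τl = A + c - y := by rw [hτl]; field_simp
  have gp : τp⁻¹ * x = M * a 0 := by
    rw [inv_mul_eq_iff_eq_mul₀ tp.ne']
    linear_combination -hx - M * ep
  have gm : τm⁻¹ * y = N * a 0 := by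
    rw [inv_mul_eq_iff_eq_mul₀ tm.ne']
    linear_combination -hy - N * em
  set α := WL.frac 0
  set β := WR.frac 0
  have wx : u₂ - x - u₂ = -x := by ring
  have wy : u₂ - y - u₂ = -y := by ring
  have j1 := acoustic_wave (E := E 0) (u₂ := u₂) (π₁ := π₁) (α := α) (ε := -1)
    (σ := (WL.phase 0).u - a 0 * (WL.phase 0).τ) (v := WL.phase 0)
    (v' := (WL.phase 0).moved τl (u₂ - y)) ha (by norm_num) (hL.2.2 0).1 (inv_pos.2 tl) rfl rfl
    (by ring) (by simp; linarith)
  have j4 := acoustic_wave (E := E 0) (u₂ := u₂) (π₁ := π₁) (α := β) (ε := 1)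
    (σ := (WR.phase 0).u + a 0 * (WR.phase 0).τ) (v := (WR.phase 0).moved τp (u₂ - x))
    (v' := WR.phase 0) ha (by norm_num) (inv_pos.2 tp) (hR.2.2 0).1 rfl rfl
    (by simp; linarith) (by ring)
  have j2 := contact_wave (E := E 0) (a := a 0) (u₂ := u₂) (π₁ := π₁) (α := α) (α' := α)
    (σ := u₂ - y) (v := (WL.phase 0).moved τl (u₂ - y))
    (v' := (WR.phase 0).moved τm (u₂ - y)) rfl rfl
    (by
      simp only [PhaseState.relPressure_moved, fL, fR]
      linear_combination α * a 0 * (fA - fB + el - em)) (.inr rfl)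
  have hQ0 := dissipation_nonneg hM1 hN hx hy hQ
  have j3 := interface_wave (E := E 0) (π₁ := π₁) (σ := u₂) (α := α) (α' := β)
    (Q := β * (M * a 0) / 2 * ((x ^ 2 - (B - c + x) ^ 2) - (y ^ 2 - (B + c - y) ^ 2)))
    (v := (WR.phase 0).moved τm (u₂ - y)) (v' := (WR.phase 0).moved τp (u₂ - x)) ha
    (inv_pos.2 tm) (inv_pos.2 tp) rfl rfl
    (by
      simp only [PhaseState.moved_ρ, PhaseState.moved_u, wx, wy, mul_assoc, mul_neg, gm, gp]
      linear_combination a 0 * hMN)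
    (by
      simp only [PhaseState.moved_ρ, PhaseState.moved_u, PhaseState.relPressure_moved,
        wy, mul_assoc, fR]
      linear_combination -hp - α * (y - x) * gm - (y - x) * a 0 * hMN
        - a 0 * (α * -hy + (B + c - y) * hMN + β * -hx)
        - a 0 * (β - α) * fB - a 0 * β * ep + a 0 * α * em)
    (by
      simp only [PhaseState.moved_ρ, PhaseState.moved_u, PhaseState.moved_τ, wx, wy, mul_assoc,
        mul_neg, gm, em, ep]
      linear_combination -a 0 / 2 * ((x ^ 2 - (B - c + x) ^ 2) - (y ^ 2 - (B + c - y) ^ 2)) * hMN)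
  refine ⟨β * (M * a 0) / 2 * ((x ^ 2 - (B - c + x) ^ 2) - (y ^ 2 - (B + c - y) ^ 2)),
    isPhaseOneSolution_of_four_waves hL hR rfl rfl (s₂ := u₂ - y) (s₃ := u₂)
    (by linarith) (by linarith) (by linarith) ((hL.2.2 0).moved tl _) ((hR.2.2 0).moved tm _)
    ((hR.2.2 0).moved tp _) (by simp; linarith) (by simp; linarith)
    (.inr ⟨rfl, rfl, rfl, rfl⟩) j1 j2.1 j3.1 j4 (fun δ => ?_) hc ?_⟩
  · rw [j2.2, j3.2]
    ring
  · positivity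

end FourWaves

/-! ### Existence of coupled phase 1 solutions -/

/-- All requirements other than `0 < M` hold strictly at `M = 0` and are continuous in `M`, so every
small positive `M` works. The last two are positivity of the specific volume beyond the material
contact and nonnegative dissipation. The latter reduces at `M = 0` to `(A - c₀)² < (A + c₀)²`. -/
theorem exists_mach {A B c₀ : ℝ} (k ν : ℝ) (hB : 0 < B) (hc : 0 < c₀) (hcA : c₀ < A) :
    ∃ M c : ℝ, c = c₀ + k * M ∧ 0 < M ∧ M < 1 ∧ 0 < c ∧ c < A ∧
      ν * M * (A + c) < (B + c) * (1 + ν * M) ∧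
      (A - c) ^ 2 * ((1 + M) * (1 + ν * M)) ≤ (A + c) ^ 2 * ((1 - M) * (1 - ν * M)) := by
  have key : ∀ f g : ℝ → ℝ, Continuous f → Continuous g → f 0 < g 0 →
      ∀ᶠ M in 𝓝[>] (0 : ℝ), f M < g M := fun f g hf hg h =>
    eventually_nhdsWithin_of_eventually_nhds
      (hf.continuousAt.eventually_lt hg.continuousAt h)
  have h1 := key (fun M => M) (fun _ => 1) (by fun_prop) (by fun_prop) one_pos
  have h2 := key (fun _ => 0) (fun M => c₀ + k * M) (by fun_prop) (by fun_prop) (by simpa)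
  have h3 := key (fun M => c₀ + k * M) (fun _ => A) (by fun_prop) (by fun_prop) (by simpa)
  have h4 := key (fun M => ν * M * (A + (c₀ + k * M)))
    (fun M => (B + (c₀ + k * M)) * (1 + ν * M)) (by fun_prop) (by fun_prop)
    (by simpa using by linarith)
  have h5 := key (fun M => (A - (c₀ + k * M)) ^ 2 * ((1 + M) * (1 + ν * M)))
    (fun M => (A + (c₀ + k * M)) ^ 2 * ((1 - M) * (1 - ν * M))) (by fun_prop) (by fun_prop)
    (by
      have : 0 < A * c₀ := mul_pos (hc.trans hcA) hc
      simp only [mul_zero, add_zero, sub_zero, mul_one]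
      linarith)
  obtain ⟨M, h0, h1, h2, h3, h4, h5⟩ :=
    ((eventually_mem_nhdsWithin (a := (0 : ℝ)) (s := Ioi 0)).and
      (h1.and (h2.and (h3.and (h4.and h5))))).exists
  exact ⟨M, _, rfl, h0, h1, h2, h3, h4, h5.le⟩

variable {E : Fin 2 → EOS} {a : Fin 2 → ℝ} {WL WR : State}

/-- The difference of velocities in the absence of mass transfer of phase 1 through the phase
fraction wave, compared with the central expression of condition (A). -/
theorem exists_factor_USharp (ha : ∀ k, 0 < a k) (hL : WL.Admissible E) (hR : WR.Admissible E) :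
    ∃ θ c₀ : ℝ, 0 < θ ∧ θ ≤ 1 ∧ c₀ = θ * USharp E a WL WR ∧
      (a 0 * (WR.frac 0 + WL.frac 0) + a 1 * (WR.frac 1 + WL.frac 1)) * c₀
        = a 1 * (WR.frac 1 + WL.frac 1) * (uSharp E a WL WR 0 - uSharp E a WL WR 1)
          + (WR.frac 0 - WL.frac 0) * (piSharp E a WL WR 0 - piSharp E a WL WR 1) := by
  have h0 := ha 0
  have h1 := ha 1
  have l0 := hL.frac_pos 0
  have r0 := hR.frac_pos 0
  have hS : 0 < WR.frac 1 + WL.frac 1 := add_pos (hR.frac_pos 1) (hL.frac_pos 1)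
  have hΔ : WR.frac 1 - WL.frac 1 = -(WR.frac 0 - WL.frac 0) := by
    rw [frac_one_eq, frac_one_eq]; ring
  have hΛ : |lambdaAlpha WL WR| = |WR.frac 0 - WL.frac 0| / (WR.frac 1 + WL.frac 1) := by
    rw [lambdaAlpha, abs_div, hΔ, abs_neg, abs_of_pos hS]
  have hle : |WR.frac 0 - WL.frac 0| ≤ WR.frac 0 + WL.frac 0 :=
    abs_le.2 ⟨by linarith, by linarith⟩
  have hnn := abs_nonneg (WR.frac 0 - WL.frac 0)
  -- The ratio of two denominators: (A) involves the absolute jump of the fractions where the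
  -- momentum balance involves their sum. The jump is at most the sum, whence `θ ≤ 1`.
  refine ⟨(a 1 * (WR.frac 1 + WL.frac 1) + a 0 * |WR.frac 0 - WL.frac 0|)
    / (a 0 * (WR.frac 0 + WL.frac 0) + a 1 * (WR.frac 1 + WL.frac 1)), _, by positivity, ?_, rfl,
    ?_⟩
  · rw [div_le_one (by positivity)]
    linarith [mul_le_mul_of_nonneg_left hle h0.le]
  · rw [USharp, hΛ, lambdaAlpha, hΔ]
    generalize |WR.frac 0 - WL.frac 0| = d at *
    generalize WR.frac 1 + WL.frac 1 = S at *
    have hd : 0 < a 1 * S + a 0 * d := by positivity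
    have hD : 0 < a 0 * (WR.frac 0 + WL.frac 0) + a 1 * S := by positivity
    have e : 1 + a 0 / a 1 * (d / S) = (a 1 * S + a 0 * d) / (a 1 * S) := by field_simp
    rw [e]
    field_simp
    ring

theorem exists_isPhaseOneSolution (ha : ∀ k, 0 < a k) (hL : WL.Admissible E)
    (hR : WR.Admissible E) (hτL : 0 < tauSharpL E a WL WR 0) (hτR : 0 < tauSharpR E a WL WR 0)
    (hA : ConditionA E a WL WR) :
    ∃ (u₂ π₁ Q : ℝ) (v : ℝ → PhaseState), IsPhaseOneSolution E a WL WR v u₂ π₁ Q := by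
  obtain ⟨θ, c₀, hθ, hθ1, hc₀, hD⟩ := exists_factor_USharp ha hL hR
  have ha0 := ha 0
  have hApos := mul_pos ha0 hτL
  have hBpos := mul_pos ha0 hτR
  have l0 := hL.frac_pos 0
  have r0 := hR.frac_pos 0
  have hS1 : 0 < a 1 * (WR.frac 1 + WL.frac 1) :=
    mul_pos (ha 1) (add_pos (hR.frac_pos 1) (hL.frac_pos 1))
  have hDpos : 0 < a 0 * (WR.frac 0 + WL.frac 0) + a 1 * (WR.frac 1 + WL.frac 1) := by positivity
  obtain ⟨hA1, hA2⟩ := hA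
  set D := a 0 * (WR.frac 0 + WL.frac 0) + a 1 * (WR.frac 1 + WL.frac 1) with hDdef
  set U := USharp E a WL WR
  -- Both phases prescribe the product of `π₁` and the jump of `α₁`. Once the prescriptions agree,
  -- `π₁` is a quotient, or arbitrary when the fraction does not jump.
  have hπ : ∀ F G : ℝ, F = G → (WR.frac 0 - WL.frac 0 = 0 → G = 0) →
      ∃ π₁, (WR.frac 0 - WL.frac 0) * π₁ = F ∧ (WR.frac 0 - WL.frac 0) * π₁ = G := by
    rintro F _ rfl h
    by_cases hΔ : WR.frac 0 - WL.frac 0 = 0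
    · exact ⟨0, by rw [h hΔ, mul_zero], by rw [h hΔ, mul_zero]⟩
    · exact ⟨F / (WR.frac 0 - WL.frac 0), by field_simp, by field_simp⟩
  have hΔ1 : WR.frac 0 - WL.frac 0 = 0 → uSharp E a WL WR 0 - uSharp E a WL WR 1 = U := by
    intro h
    have : lambdaAlpha WL WR = 0 := by
      rw [lambdaAlpha, frac_one_eq, frac_one_eq]
      have : 1 - WR.frac 0 - (1 - WL.frac 0) = 0 := by linarith
      rw [this, zero_div]
    simp [U, USharp, this]
  rcases lt_trichotomy U 0 with hU | hU | hU
  · have hd0 : 0 < -c₀ := by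
      rw [hc₀]; linarith [mul_neg_of_pos_of_neg hθ hU]
    have hdB : -c₀ < a 0 * tauSharpR E a WL WR 0 := by
      rw [hc₀]; linarith [mul_nonneg (sub_nonneg.2 hθ1) (neg_pos.2 hU).le]
    -- With equal fractions the coupling forces `u₂ = u♯_2`, and the phase 1 momentum balance then
    -- forces `M = -U / B`. Here `N = M` and the dissipation inequality is an equality.
    by_cases hΔ : WR.frac 0 - WL.frac 0 = 0
    · have hu := hΔ1 hΔ
      have hαβ : WR.frac 0 = WL.frac 0 := by linarith
      set B := a 0 * tauSharpR E a WL WR 0 with hBdef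
      have hM : 0 < -U / B := div_pos (by linarith) hBpos
      have hM1 : -U / B < 1 := by rw [div_lt_one hBpos]; linarith
      have hMB : -U / B * B = -U := by field_simp
      have e : uSharp E a WL WR 1 - uSharp E a WL WR 0 = -U := by linarith
      refine ⟨uSharp E a WL WR 1, 0, exists_isPhaseOneSolution_of_leftward (M := -U / B)
        (N := -U / B) ha0 hL hR hM hM1 hM (by rw [hαβ]) (by linarith) ?_ ?_ ?_ (by rw [hΔ]; ring)
        ?_⟩ <;> rw [e]
      · linarith
      · rw [← hBdef]
        have : 0 < a 0 * tauSharpL E a WL WR 0 * (1 + -U / B) := by positivity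
        linarith
      · rw [← hBdef]
        generalize -U / B = M at *
        rw [← hMB]
        exact le_of_eq (by ring)
      · rw [← hBdef, hΔ, hαβ]
        linear_combination 2 * a 0 * WL.frac 0 * hMB
    -- The slope is the one for which the phase 1 momentum balance and the coupling give the same
    -- `π₁`; `d` is `u₂ - u♯_1`.
    · obtain ⟨M, d, hd, hM, hM1, hd1, hd2, h3, h4⟩ := exists_mach
        (2 * a 0 * WR.frac 0 * (a 0 * tauSharpR E a WL WR 0) / D) (WR.frac 0 / WL.frac 0)
        hApos hd0 hdB
      have hDd : D * d = -(D * c₀) + 2 * a 0 * WR.frac 0 * M * (a 0 * tauSharpR E a WL WR 0) := by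
        rw [hd]; field_simp
      obtain ⟨π₁, hF, hG⟩ := hπ ((WR.frac 0 - WL.frac 0) * piSharp E a WL WR 1
        - a 1 * (WR.frac 1 + WL.frac 1) * (uSharp E a WL WR 0 + d - uSharp E a WL WR 1))
        ((WR.frac 0 - WL.frac 0) * piSharp E a WL WR 0 + a 0 * (WR.frac 0 + WL.frac 0) * d
        - 2 * a 0 * WR.frac 0 * M * (a 0 * tauSharpR E a WL WR 0))
        (by linear_combination -hDd + hD + d * hDdef) (absurd · hΔ)
      have e : uSharp E a WL WR 0 + d - uSharp E a WL WR 0 = d := by ring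
      refine ⟨uSharp E a WL WR 0 + d, π₁, exists_isPhaseOneSolution_of_leftward (M := M)
        (N := WR.frac 0 / WL.frac 0 * M) ha0 hL hR hM hM1 (by positivity) (by field_simp)
        (by linarith) ?_ ?_ ?_ hF ?_⟩ <;> rwa [e]
  -- Here `u₂ = u♯_1`, and the material contact of phase 1 coincides with the interface.
  · have hc : c₀ = 0 := by rw [hc₀, hU, mul_zero]
    obtain ⟨π₁, hF, hG⟩ := hπ ((WR.frac 0 - WL.frac 0) * piSharp E a WL WR 1
      - a 1 * (WR.frac 1 + WL.frac 1) * (uSharp E a WL WR 0 - uSharp E a WL WR 1))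
      ((WR.frac 0 - WL.frac 0) * piSharp E a WL WR 0) (by rw [hc] at hD; linear_combination hD)
      (fun h => by rw [h, zero_mul])
    obtain ⟨v, hv⟩ := exists_isPhaseOneSolution_of_contact (u₂ := uSharp E a WL WR 0) (π₁ := π₁)
      ha0 hL hR (by linarith) (by linarith) hF (by rw [hG]; ring)
    exact ⟨_, _, _, v, hv⟩
  · have hd0 : 0 < c₀ := by rw [hc₀]; positivity
    have hdA : c₀ < a 0 * tauSharpL E a WL WR 0 := by
      rw [hc₀]; linarith [mul_nonneg (sub_nonneg.2 hθ1) hU.le]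
    by_cases hΔ : WR.frac 0 - WL.frac 0 = 0
    · have hu := hΔ1 hΔ
      have hαβ : WR.frac 0 = WL.frac 0 := by linarith
      set A := a 0 * tauSharpL E a WL WR 0 with hAdef
      have hM : 0 < U / A := div_pos hU hApos
      have hM1 : U / A < 1 := by rw [div_lt_one hApos]; linarith
      have hMA : U / A * A = U := by field_simp
      refine ⟨uSharp E a WL WR 1, 0, exists_isPhaseOneSolution_of_rightward (M := U / A)
        (N := U / A) ha0 hL hR hM hM1 hM (by rw [hαβ]) (by linarith) ?_ ?_ ?_ (by rw [hΔ]; ring)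
        ?_⟩ <;> rw [hu]
      · linarith
      · rw [← hAdef]
        have : 0 < a 0 * tauSharpR E a WL WR 0 * (1 + U / A) := by positivity
        linarith
      · rw [← hAdef]
        generalize U / A = M at *
        rw [← hMA]
        exact le_of_eq (by ring)
      · rw [← hAdef, hΔ, hαβ]
        linear_combination -2 * a 0 * WL.frac 0 * hMA
    -- Same choice of slope as in the leftward case, with left and right exchanged; now `d` is `u♯_1
    -- - u₂`.
    · obtain ⟨M, d, hd, hM, hM1, hd1, hd2, h3, h4⟩ := exists_mach
        (2 * a 0 * WL.frac 0 * (a 0 * tauSharpL E a WL WR 0) / D) (WL.frac 0 / WR.frac 0)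
        hBpos hd0 hdA
      have hDd : D * d = D * c₀ + 2 * a 0 * WL.frac 0 * M * (a 0 * tauSharpL E a WL WR 0) := by
        rw [hd]; field_simp
      obtain ⟨π₁, hF, hG⟩ := hπ ((WR.frac 0 - WL.frac 0) * piSharp E a WL WR 1
        - a 1 * (WR.frac 1 + WL.frac 1) * (uSharp E a WL WR 0 - d - uSharp E a WL WR 1))
        ((WR.frac 0 - WL.frac 0) * piSharp E a WL WR 0 - a 0 * (WR.frac 0 + WL.frac 0) * d
        + 2 * a 0 * WL.frac 0 * M * (a 0 * tauSharpL E a WL WR 0))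
        (by linear_combination hDd + hD - d * hDdef) (absurd · hΔ)
      have e : uSharp E a WL WR 0 - (uSharp E a WL WR 0 - d) = d := by ring
      refine ⟨uSharp E a WL WR 0 - d, π₁, exists_isPhaseOneSolution_of_rightward (M := M)
        (N := WL.frac 0 / WR.frac 0 * M) ha0 hL hR hM hM1 (by positivity) (by field_simp)
        (by linarith) ?_ ?_ ?_ hF ?_⟩ <;> rwa [e]

end BaerNunziato

end

theorem mainTheorem3 (E : Fin 2 → BaerNunziato.EOS) (a : Fin 2 → ℝ)
    (WL WR : BaerNunziato.State)
    (ha : ∀ k, 0 < a k)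
    (hL : WL.Admissible E) (hR : WR.Admissible E)
    (hτL : ∀ k, 0 < BaerNunziato.tauSharpL E a WL WR k)
    (hτR : ∀ k, 0 < BaerNunziato.tauSharpR E a WL WR k)
    (hA : BaerNunziato.ConditionA E a WL WR) :
    (∃ (u₂ π₁ Q : ℝ) (v : ℝ → BaerNunziato.PhaseState),
      BaerNunziato.IsPhaseOneSolution E a WL WR v u₂ π₁ Q) ∧
    ∀ (u₂ π₁ Q : ℝ) (v : ℝ → BaerNunziato.PhaseState),
      BaerNunziato.IsPhaseOneSolution E a WL WR v u₂ π₁ Q →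
      BaerNunziato.ConditionB E a WL WR u₂ →
      ∃ W : ℝ → BaerNunziato.State,
        BaerNunziato.IsSubsonicSolution E a WL WR W u₂ π₁ Q ∧ ∀ ξ, (W ξ).phase 0 = v ξ :=
  ⟨BaerNunziato.exists_isPhaseOneSolution ha hL hR (hτL 0) (hτR 0) hA,
    fun _ _ _ _ hv hB => hv.exists_isSubsonicSolution ha hL hR hB⟩
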